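/- Let $X$ be a separable real Banach space with dual $X^*$. Let $Q:X^*\to X$ be bounded, linear, symmetric and nonnegative ($\langle Qx^*,y^*\rangle=\langle Qy^*,x^*\rangle$ and $\langle Qx^*,x^*\rangle\ge 0$), and let $H$ be its reproducing kernel Hilbert space, i.e. the completion of $QX^*$ for the inner product $[Qx^*,Qy^*]_H=\langle Qx^*,y^*\rangle$, with injection $i:H\to X$ and adjoint $i^*:X^*\to H$, so that $Q=i\,i^*$. Let $A$ be the generator of a strongly continuous contraction semigroup $(e^{tA})_{t\ge0}$ on $X$, and let $Q_t:=\int_0^t e^{sA}Qe^{sA^*}\,ds$. Assume: (a) for every $t>0$, $Q_t$ is the covariance operator of a centred Gaussian measure on $X$; for every $x^*\in X^*$ the weak limit $Q_\infty x^*:=\lim_{t\to+\infty}Q_tx^*$ exists, and $Q_\infty$ is the covariance operator of a centred nondegenerate Gaussian measure $\mu_\infty$ on $X$ (its topological support is $X$); (b) there is $c>0$ such that for all $x^*\in D(A^*)$ one has $Q_\infty A^*x^*\in H$ and $|Q_\infty A^*x^*|_H\le c\,|i^*x^*|_H$. Let $B\in\mathcal L(H)$ be the unique bounded operator with $B\,i^*x^*=Q_\infty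 A^*x^*$ for all $x^*\in D(A^*)$, and let $B^*$ be its adjoint; (c) $U:X\to(-\infty,+\infty]$ is a proper, lower semicontinuous, convex function which belongs to $W^{1,p}_H(X,\mu_\infty)$ for every $p\in[1,+\infty)$. Put $\nu_\infty:=e^{-U}\mu_\infty$. Here $\mathscr{FC}^1_b(X)$ is the space of functions $f(x)=\varphi(\langle x,x_1^*\rangle,\dots,\langle x,x_n^*\rangle)$ with $n\in\mathbb N$, $x_1^*,\dots,x_n^*\in X^*$ and $\varphi\in C^1_b(\mathbb R^n)$; $D_Hf:=i^*Df$ for such $f$; and for a measure $\gamma\in\{\mu_\infty,\nu_\infty\}$, $W^{1,p}_H(X,\gamma)$ is the domain of the closure in $L^p(X,\gamma)$ (again denoted by $D_H$) of $D_H:\mathscr{FC}^1_b(X)\to L^p(X,\gamma;H)$. Let $L_2$ be the operator on $L^2(X,\nu_\infty)$ with domain $$D(L_2)=\Big\{u\in W^{1,2}_H(X,\nu_\infty):\ \exists\, g\in L^2(X,\nu_\infty)\ \text{ with }\ -\int_X[BD_Hu,D_Hv]_H\,d\nu_\infty=-\int_X g\,v\,d\nu_\infty\ \ \forall v\in\mathscr{FC}^1_b(X)\Big\},\qquad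 L_2u:=g,$$ and let $\widetilde L_2$ be the operator defined in the same way with $B^*$ in place of $B$. Then $D(\widetilde L_2)=D(L_2^*)$ and $\widetilde L_2u=L_2^*u$ for every $u\in D(L_2^*)$, where $L_2^*$ is the Hilbert space adjoint of $L_2$ in $L^2(X,\nu_\infty)$. Moreover $L_2$ and $\widetilde L_2$ generate strongly continuous contraction semigroups $(T_2(t))_{t\ge0}$ and $(\widetilde T_2(t))_{t\ge0}$ on $L^2(X,\nu_\infty)$, and $\widetilde T_2(t)=T_2(t)^*$ for every $t\ge0$. -/

import Mathlib

open MeasureTheory Filter Topology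
open scoped NNReal ENNReal InnerProductSpace

namespace OrnsteinUhlenbeck

noncomputable section

/-! ### Nonnegative symmetric operators and their reproducing kernel Hilbert spaces -/

/-- A bounded linear operator `Q : X* → X` which is symmetric and nonnegative. -/
structure NonnegSymmOp (X : Type*) [NormedAddCommGroup X] [NormedSpace ℝ X] where
  /-- the underlying bounded linear operator -/
  op : StrongDual ℝ X →L[ℝ] X
  symm : ∀ a b : StrongDual ℝ X, b (op a) = a (op b)
  nonneg : ∀ a : StrongDual ℝ X, 0 ≤ a (op a)

section RKHS

variable {X : Type*} [NormedAddCommGroup X] [NormedSpace ℝ X]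

/-- The vector space `X*`, to be equipped with the semi-inner product `⟨Q a, b⟩`. -/
def PreKernelSpace (_Q : NonnegSymmOp X) : Type _ := StrongDual ℝ X

instance (Q : NonnegSymmOp X) : AddCommGroup (PreKernelSpace Q) :=
  inferInstanceAs (AddCommGroup (StrongDual ℝ X))

instance (Q : NonnegSymmOp X) : Module ℝ (PreKernelSpace Q) :=
  inferInstanceAs (Module ℝ (StrongDual ℝ X))

/-- The identity map from `X*` to `PreKernelSpace Q`. -/
def toPre (Q : NonnegSymmOp X) : StrongDual ℝ X ≃ₗ[ℝ] PreKernelSpace Q :=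
  LinearEquiv.refl ℝ (StrongDual ℝ X)

/-- The semi-inner product `⟨Q a, b⟩` on `X*`. -/
@[reducible] def kernelCore (Q : NonnegSymmOp X) : PreInnerProductSpace.Core ℝ (PreKernelSpace Q) where
  inner a b := ((toPre Q).symm b) (Q.op ((toPre Q).symm a))
  conj_inner_symm a b := by
    simpa using Q.symm _ _
  re_inner_nonneg a := by simpa using Q.nonneg _
  add_left a b c := by simp
  smul_left a b r := by simp

instance (Q : NonnegSymmOp X) : SeminormedAddCommGroup (PreKernelSpace Q) :=
  @InnerProductSpace.Core.toSeminormedAddCommGroup ℝ (PreKernelSpace Q) _ _ _ (kernelCore Q)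

instance (Q : NonnegSymmOp X) : InnerProductSpace ℝ (PreKernelSpace Q) :=
  InnerProductSpace.ofCore (kernelCore Q)

/-- The reproducing kernel Hilbert space `H` of `Q`: the completion of `Q X*` (that is, of `X*`
modulo the kernel of `Q`) for the inner product `[Q a, Q b]_H = ⟨Q a, b⟩`. It is realised as a
subspace of `X` by the injection `inclusion Q` below. -/
abbrev KernelSpace (Q : NonnegSymmOp X) : Type _ := UniformSpace.Completion (PreKernelSpace Q)

/-- The canonical map `X* → H`, sending `a` to the element of `H` represented by `Q a`. -/
def toKernel (Q : NonnegSymmOp X) : StrongDual ℝ X →ₗ[ℝ] KernelSpace Q :=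
  (UniformSpace.Completion.toComplL (𝕜 := ℝ) (E := PreKernelSpace Q)).toLinearMap ∘ₗ
    (toPre Q).toLinearMap

theorem inner_toKernel (Q : NonnegSymmOp X) (a b : StrongDual ℝ X) :
    ⟪toKernel Q a, toKernel Q b⟫_ℝ = b (Q.op a) :=
  UniformSpace.Completion.inner_coe (𝕜 := ℝ) (E := PreKernelSpace Q) (toPre Q a) (toPre Q b)

theorem denseRange_toKernel (Q : NonnegSymmOp X) : DenseRange (toKernel Q) :=
  UniformSpace.Completion.denseRange_coe (α := PreKernelSpace Q)

theorem norm_op_le (Q : NonnegSymmOp X) (a : StrongDual ℝ X) :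
    ‖Q.op a‖ ≤ Real.sqrt ‖Q.op‖ * ‖toKernel Q a‖ := by
  refine NormedSpace.norm_le_dual_bound ℝ (Q.op a) (by positivity) fun b => ?_
  rw [← inner_toKernel]
  refine (norm_inner_le_norm _ _).trans ?_
  have hb : ‖toKernel Q b‖ ≤ Real.sqrt ‖Q.op‖ * ‖b‖ := by
    refine abs_le_of_sq_le_sq' ?_ (by positivity) |>.2
    rw [← real_inner_self_eq_norm_sq, inner_toKernel, mul_pow, Real.sq_sqrt (norm_nonneg Q.op)]
    calc b (Q.op b) ≤ ‖b (Q.op b)‖ := Real.le_norm_self _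
      _ ≤ ‖b‖ * ‖Q.op b‖ := b.le_opNorm _
      _ ≤ ‖b‖ * (‖Q.op‖ * ‖b‖) := by gcongr; exact Q.op.le_opNorm _
      _ = ‖Q.op‖ * ‖b‖ ^ 2 := by ring
  calc ‖toKernel Q a‖ * ‖toKernel Q b‖ ≤ ‖toKernel Q a‖ * (Real.sqrt ‖Q.op‖ * ‖b‖) := by gcongr
    _ = _ := by ring

variable [CompleteSpace X]

/-- The continuous inclusion `i : H → X`, the extension of `Q X* ⊆ X`. -/
def inclusion (Q : NonnegSymmOp X) : KernelSpace Q →L[ℝ] X :=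
  (Q.op : StrongDual ℝ X →ₗ[ℝ] X).extendOfNorm (toKernel Q)

theorem inclusion_toKernel (Q : NonnegSymmOp X) (a : StrongDual ℝ X) :
    inclusion Q (toKernel Q a) = Q.op a :=
  LinearMap.extendOfNorm_eq (denseRange_toKernel Q) ⟨_, norm_op_le Q⟩ a

/-- The adjoint `i* : X* → H` of the inclusion, `H` being identified with its dual. -/
def inclusionAdj (Q : NonnegSymmOp X) : StrongDual ℝ X →L[ℝ] KernelSpace Q :=
  LinearMap.mkContinuous
    { toFun := fun a => (InnerProductSpace.toDual ℝ (KernelSpace Q)).symm (a ∘L inclusion Q)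
      map_add' := fun a b => by simp [ContinuousLinearMap.add_comp]
      map_smul' := fun c a => by simp [ContinuousLinearMap.smul_comp] }
    ‖inclusion Q‖ fun a => by
      simpa [mul_comm] using ContinuousLinearMap.opNorm_comp_le a (inclusion Q)

theorem inner_inclusionAdj (Q : NonnegSymmOp X) (a : StrongDual ℝ X) (h : KernelSpace Q) :
    ⟪inclusionAdj Q a, h⟫_ℝ = a (inclusion Q h) := by
  simp [inclusionAdj]

theorem inclusionAdj_eq (Q : NonnegSymmOp X) (a : StrongDual ℝ X) :
    inclusionAdj Q a = toKernel Q a := by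
  refine ext_inner_right ℝ fun h => ?_
  rw [inner_inclusionAdj]
  refine (denseRange_toKernel Q).induction_on
    (p := fun h => a (inclusion Q h) = ⟪toKernel Q a, h⟫_ℝ) h ?_ ?_
  · exact isClosed_eq (by fun_prop) (by fun_prop)
  · intro b
    rw [inclusion_toKernel, inner_toKernel, Q.symm]

/-- `Q = i ∘ i*`. -/
theorem inclusion_inclusionAdj (Q : NonnegSymmOp X) (a : StrongDual ℝ X) :
    inclusion Q (inclusionAdj Q a) = Q.op a := by
  rw [inclusionAdj_eq, inclusion_toKernel]

theorem inclusion_injective (Q : NonnegSymmOp X) : Function.Injective (inclusion Q) := by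
  rw [injective_iff_map_eq_zero]
  intro h hh
  refine (denseRange_toKernel Q).eq_zero_of_inner_left ℝ fun a => ?_
  rw [real_inner_comm, ← inclusionAdj_eq, inner_inclusionAdj, hh, map_zero]

end RKHS

/-! ### Strongly continuous contraction semigroups and their generators -/

section Semigroup

variable {E : Type*} [NormedAddCommGroup E] [NormedSpace ℝ E]

/-- `S` is a strongly continuous semigroup of contractions on `E`. -/
structure IsContractionSemigroup (S : ℝ≥0 → E →L[ℝ] E) : Prop where
  zero : S 0 = ContinuousLinearMap.id ℝ E
  add : ∀ s t, S (s + t) = S s ∘L S t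
  contraction : ∀ t, ‖S t‖ ≤ 1
  strong : ∀ x, Tendsto (fun t => S t x) (𝓝 0) (𝓝 x)

/-- The graph of the generator: pairs `(x, y)` with `(S t x - x) / t → y` as `t → 0+`. -/
def generatorGraph (S : ℝ≥0 → E →L[ℝ] E) : Submodule ℝ (E × E) where
  carrier := {w | Tendsto (fun t : ℝ≥0 => (t : ℝ)⁻¹ • (S t w.1 - w.1)) (𝓝[>] 0) (𝓝 w.2)}
  zero_mem' := by simp
  add_mem' {v w} hv hw := by
    refine (Tendsto.add hv hw).congr fun t => ?_
    simp only [Prod.fst_add, map_add, ← smul_add]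
    congr 1; abel
  smul_mem' c w hw := by
    refine (Tendsto.const_smul hw c).congr fun t => ?_
    simp only [Prod.smul_fst, map_smul, ← smul_sub]
    rw [smul_comm]

/-- The infinitesimal generator of `S`, as an unbounded operator. -/
def generator (S : ℝ≥0 → E →L[ℝ] E) : E →ₗ.[ℝ] E := (generatorGraph S).toLinearPMap

theorem generator_graph (S : ℝ≥0 → E →L[ℝ] E) : (generator S).graph = generatorGraph S := by
  refine Submodule.toLinearPMap_graph_eq _ ?_
  rintro ⟨x, y⟩ hx rfl
  refine tendsto_nhds_unique (f := fun _ : ℝ≥0 => (0 : E)) (l := 𝓝[>] 0) ?_ tendsto_const_nhds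
  simpa [generatorGraph] using hx

/-- The graph of the adjoint `A*` of an operator `A` on `E`: the pairs `(a, b)` of functionals with
`⟨A x, a⟩ = ⟨x, b⟩` for all `x ∈ D(A)`. -/
def dualAdjointGraph (A : E →ₗ.[ℝ] E) : Submodule ℝ (StrongDual ℝ E × StrongDual ℝ E) where
  carrier := {w | ∀ x : A.domain, w.1 (A x) = w.2 x}
  zero_mem' := by simp
  add_mem' {v w} hv hw x := by simp [hv x, hw x]
  smul_mem' c w hw x := by simp [hw x]

/-- The adjoint `A*` of a densely defined operator `A` on `E`, as an unbounded operator on the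
dual space `E*`. -/
def dualAdjoint (A : E →ₗ.[ℝ] E) : StrongDual ℝ E →ₗ.[ℝ] StrongDual ℝ E :=
  (dualAdjointGraph A).toLinearPMap

theorem dualAdjoint_graph (A : E →ₗ.[ℝ] E) (hA : Dense (A.domain : Set E)) :
    (dualAdjoint A).graph = dualAdjointGraph A := by
  refine Submodule.toLinearPMap_graph_eq _ ?_
  rintro ⟨a, b⟩ hab rfl
  ext x
  refine hA.induction (P := fun x => b x = (0 : StrongDual ℝ E) x) ?_ ?_ x
  · intro y hy
    exact (hab ⟨y, hy⟩).symm
  · exact isClosed_eq (by fun_prop) (by fun_prop)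

end Semigroup

section Main

variable {X : Type*} [NormedAddCommGroup X] [NormedSpace ℝ X]

/-! ### Gaussian measures and covariance operators -/

/-- `Q_t a = ∫₀ᵗ S(s) Q S(s)* a ds`. -/
def covarianceAt (Q : NonnegSymmOp X) (S : ℝ≥0 → X →L[ℝ] X) (t : ℝ) (a : StrongDual ℝ X) : X :=
  ∫ s in (0 : ℝ)..t, S s.toNNReal (Q.op (a ∘L S s.toNNReal))

/-- `μ` is a centred Gaussian measure on `X` with covariance operator `R : X* → X`. -/
structure IsCenteredGaussian [MeasurableSpace X] (μ : Measure X) (R : StrongDual ℝ X → X) :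
    Prop where
  gaussian : ProbabilityTheory.IsGaussian μ
  centered : ∀ a : StrongDual ℝ X, ∫ x, a x ∂μ = 0
  covariance : ∀ a b : StrongDual ℝ X, b (R a) = ∫ x, a x * b x ∂μ

/-! ### Cylindrical functions, the gradient along `H`, Sobolev spaces -/

/-- `φ ∈ C_b^1(ℝⁿ)`. -/
structure IsCb1 {n : ℕ} (φ : (Fin n → ℝ) → ℝ) : Prop where
  contDiff : ContDiff ℝ 1 φ
  bounded : ∃ C, ∀ y, ‖φ y‖ ≤ C
  bounded_fderiv : ∃ C, ∀ y, ‖fderiv ℝ φ y‖ ≤ C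

/-- `f` is a cylindrical function `f(x) = φ(⟨x, ξ₁⟩, …, ⟨x, ξₙ⟩)` with `φ ∈ C_b^1(ℝⁿ)` and
`ξ₁, …, ξₙ ∈ X*`. -/
def IsCylindrical (f : X → ℝ) : Prop :=
  ∃ (n : ℕ) (φ : (Fin n → ℝ) → ℝ) (ξ : Fin n → StrongDual ℝ X),
    IsCb1 φ ∧ ∀ x, f x = φ (fun j => ξ j x)

theorem IsCb1.comp {m n : ℕ} {φ : (Fin n → ℝ) → ℝ} (h : IsCb1 φ)
    (P : (Fin m → ℝ) →L[ℝ] (Fin n → ℝ)) : IsCb1 (fun y => φ (P y)) where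
  contDiff := h.contDiff.comp P.contDiff
  bounded := by
    obtain ⟨C, hC⟩ := h.bounded
    exact ⟨C, fun y => hC _⟩
  bounded_fderiv := by
    obtain ⟨C, hC⟩ := h.bounded_fderiv
    refine ⟨C * ‖P‖, fun y => ?_⟩
    have hd : HasFDerivAt (fun y => φ (P y)) ((fderiv ℝ φ (P y)) ∘L P) y :=
      ((h.contDiff.differentiable one_ne_zero) (P y)).hasFDerivAt.comp y P.hasFDerivAt
    rw [hd.fderiv]
    refine (ContinuousLinearMap.opNorm_comp_le _ _).trans ?_
    gcongr
    exact hC _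

theorem IsCb1.add {n : ℕ} {φ ψ : (Fin n → ℝ) → ℝ} (h : IsCb1 φ) (k : IsCb1 ψ) :
    IsCb1 (fun y => φ y + ψ y) where
  contDiff := h.contDiff.add k.contDiff
  bounded := by
    obtain ⟨C, hC⟩ := h.bounded
    obtain ⟨D, hD⟩ := k.bounded
    exact ⟨C + D, fun y => (norm_add_le _ _).trans (add_le_add (hC y) (hD y))⟩
  bounded_fderiv := by
    obtain ⟨C, hC⟩ := h.bounded_fderiv
    obtain ⟨D, hD⟩ := k.bounded_fderiv
    refine ⟨C + D, fun y => ?_⟩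
    rw [fderiv_fun_add (h.contDiff.differentiable one_ne_zero y)
      (k.contDiff.differentiable one_ne_zero y)]
    exact (norm_add_le _ _).trans (add_le_add (hC y) (hD y))

theorem IsCylindrical.add {f g : X → ℝ} (hf : IsCylindrical f) (hg : IsCylindrical g) :
    IsCylindrical (f + g) := by
  obtain ⟨n, φ, ξ, hφ, hf⟩ := hf
  obtain ⟨m, ψ, η, hψ, hg⟩ := hg
  refine ⟨n + m, fun y => φ (fun j => y (Fin.castAdd m j)) + ψ (fun j => y (Fin.natAdd n j)),
    Fin.append ξ η, IsCb1.add (hφ.comp (ContinuousLinearMap.pi fun j =>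
      ContinuousLinearMap.proj (Fin.castAdd m j))) (hψ.comp (ContinuousLinearMap.pi fun j =>
      ContinuousLinearMap.proj (Fin.natAdd n j))), fun x => ?_⟩
  simp [hf, hg]

theorem isCylindrical_const (c : ℝ) : IsCylindrical (fun _ : X => c) :=
  ⟨0, fun _ => c, Fin.elim0, ⟨contDiff_const, ⟨‖c‖, fun _ => le_rfl⟩, ⟨0, by simp⟩⟩, by simp⟩

theorem IsCylindrical.smul {f : X → ℝ} (c : ℝ) (hf : IsCylindrical f) :
    IsCylindrical (c • f) := by
  obtain ⟨n, φ, ξ, hφ, hf⟩ := hf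
  refine ⟨n, fun y => c * φ y, ξ, ⟨contDiff_const.mul hφ.contDiff, ?_, ?_⟩, fun x => by simp [hf]⟩
  · obtain ⟨C, hC⟩ := hφ.bounded
    refine ⟨‖c‖ * C, fun y => ?_⟩
    rw [norm_mul]
    gcongr
    exact hC y
  · obtain ⟨C, hC⟩ := hφ.bounded_fderiv
    refine ⟨‖c‖ * C, fun y => ?_⟩
    rw [fderiv_const_mul (hφ.contDiff.differentiable one_ne_zero y), norm_smul]
    gcongr
    exact hC y

theorem IsCylindrical.differentiable {f : X → ℝ} (hf : IsCylindrical f) :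
    Differentiable ℝ f := by
  obtain ⟨n, φ, ξ, hφ, hf⟩ := hf
  rw [funext hf]
  exact (hφ.contDiff.differentiable one_ne_zero).comp
    (differentiable_pi.2 fun j => (ξ j).differentiable)

variable [CompleteSpace X]

/-- The gradient along `H`: `D_H f(x) = i* Df(x)`. -/
def gradient (Q : NonnegSymmOp X) (f : X → ℝ) (x : X) : KernelSpace Q :=
  inclusionAdj Q (fderiv ℝ f x)

/-- The formula `D_H f(x) = ∑ⱼ ∂ⱼφ(⟨x, ξ₁⟩, …, ⟨x, ξₙ⟩) i* ξⱼ` for cylindrical functions. -/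
theorem gradient_cylindrical (Q : NonnegSymmOp X) {n : ℕ} {φ : (Fin n → ℝ) → ℝ} (hφ : IsCb1 φ)
    (ξ : Fin n → StrongDual ℝ X) (x : X) :
    gradient Q (fun x => φ (fun j => ξ j x)) x =
      ∑ j, fderiv ℝ φ (fun j => ξ j x) (Pi.single j 1) • inclusionAdj Q (ξ j) := by
  have hd : HasFDerivAt (fun x => φ (fun j => ξ j x))
      ((fderiv ℝ φ (fun j => ξ j x)) ∘L ContinuousLinearMap.pi ξ) x :=
    ((hφ.contDiff.differentiable one_ne_zero) _).hasFDerivAt.comp x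
      (ContinuousLinearMap.pi ξ).hasFDerivAt
  rw [gradient, hd.fderiv]
  simp only [← map_smul, ← map_sum]
  congr 1
  ext y
  have : ContinuousLinearMap.pi ξ y = ∑ j, ξ j y • (Pi.single j 1 : Fin n → ℝ) := by
    ext k
    simp [Pi.single_apply]
  rw [ContinuousLinearMap.comp_apply, this, map_sum]
  simp [mul_comm]

variable [MeasurableSpace X]

/-- The graph in `L^p(X, ν) × L^p(X, ν; H)` of `D_H` on the cylindrical `C_b^1` functions. -/
def gradientGraph (Q : NonnegSymmOp X) (p : ℝ≥0∞) [Fact (1 ≤ p)] (ν : Measure X) :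
    Submodule ℝ (Lp ℝ p ν × Lp (KernelSpace Q) p ν) where
  carrier := {w | ∃ f : X → ℝ, IsCylindrical f ∧ w.1 =ᵐ[ν] f ∧ w.2 =ᵐ[ν] gradient Q f}
  zero_mem' := by
    refine ⟨fun _ => 0, isCylindrical_const 0, Lp.coeFn_zero _ _ _, ?_⟩
    refine (Lp.coeFn_zero _ _ _).trans (Eventually.of_forall fun x => ?_)
    simp [gradient]
  add_mem' := by
    rintro v w ⟨f, hf, hf1, hf2⟩ ⟨g, hg, hg1, hg2⟩
    refine ⟨f + g, hf.add hg, (Lp.coeFn_add _ _).trans (hf1.add hg1),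
      (Lp.coeFn_add _ _).trans ?_⟩
    filter_upwards [hf2, hg2] with x h1 h2
    rw [Pi.add_apply, h1, h2, gradient, gradient, gradient,
      fderiv_add (hf.differentiable x) (hg.differentiable x), map_add]
  smul_mem' := by
    rintro c w ⟨f, hf, hf1, hf2⟩
    refine ⟨c • f, hf.smul c, (Lp.coeFn_smul _ _).trans (hf1.const_smul c),
      (Lp.coeFn_smul _ _).trans ?_⟩
    filter_upwards [hf2] with x h1
    rw [Pi.smul_apply, h1, gradient, gradient, fderiv_const_smul (hf.differentiable x), map_smul]

/-- The closure of `D_H` in `L^p(X, ν)`: the unbounded operator whose graph is the closure of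
the graph of `D_H` on cylindrical functions. -/
def gradientClosure (Q : NonnegSymmOp X) (p : ℝ≥0∞) [Fact (1 ≤ p)] (ν : Measure X) :
    Lp ℝ p ν →ₗ.[ℝ] Lp (KernelSpace Q) p ν :=
  (gradientGraph Q p ν).topologicalClosure.toLinearPMap

/-- The Sobolev space `W^{1,p}_H(X, ν)`, the domain of the closure of `D_H`. -/
def sobolev (Q : NonnegSymmOp X) (p : ℝ≥0∞) [Fact (1 ≤ p)] (ν : Measure X) :
    Submodule ℝ (Lp ℝ p ν) :=
  (gradientClosure Q p ν).domain

/-- `D_H : W^{1,p}_H(X, ν) → L^p(X, ν; H)`. -/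
def sobolevGradient (Q : NonnegSymmOp X) (p : ℝ≥0∞) [Fact (1 ≤ p)] (ν : Measure X) :
    sobolev Q p ν →ₗ[ℝ] Lp (KernelSpace Q) p ν :=
  (gradientClosure Q p ν).toFun

/-! ### The weighted measure -/

/-- The measure `e^{-U} μ`, with `e^{-∞} = 0`. -/
def weightedMeasure (μ : Measure X) (U : X → EReal) : Measure X :=
  μ.withDensity fun x => EReal.exp (-U x)

/-- `U : X → (-∞, +∞]` is a proper, lower semicontinuous, convex function which belongs to
`W^{1,p}_H(X, μ)` for every `p ∈ [1, ∞)`. -/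
structure IsWeightFunction (Q : NonnegSymmOp X) (μ : Measure X) (U : X → EReal) : Prop where
  ne_bot : ∀ x, U x ≠ ⊥
  proper : ∃ x, U x ≠ ⊤
  lsc : LowerSemicontinuous U
  convex_epigraph : Convex ℝ {w : X × ℝ | U w.1 ≤ (w.2 : EReal)}
  mem_sobolev : ∀ (p : ℝ≥0∞) [Fact (1 ≤ p)], p ≠ ∞ →
    ∃ u : Lp ℝ p μ, u ∈ sobolev Q p μ ∧ ∀ᵐ x ∂μ, ((u x : ℝ) : EReal) = U x

/-! ### The operator `B`, the bilinear forms and the associated operators -/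

/-- `Q_∞ A* ξ ∈ H` for all `ξ ∈ D(A*)`, with `|Q_∞ A* ξ|_H ≤ c |i* ξ|_H`; here
`Q_∞ : X* → X` is regarded as the map `i_∞*` into the Cameron-Martin space, a subspace of `X`. -/
def DriftBound (Q : NonnegSymmOp X) (A : X →ₗ.[ℝ] X) (Qinf : StrongDual ℝ X →L[ℝ] X) : Prop :=
  ∃ c > 0, ∀ ξ : (dualAdjoint A).domain, ∃ h : KernelSpace Q,
    inclusion Q h = Qinf (dualAdjoint A ξ) ∧ ‖h‖ ≤ c * ‖inclusionAdj Q ξ‖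

/-- `B ∈ 𝓛(H)` satisfies `B i* ξ = Q_∞ A* ξ` for all `ξ ∈ D(A*)`. -/
def IsDriftOperator (Q : NonnegSymmOp X) (A : X →ₗ.[ℝ] X) (Qinf : StrongDual ℝ X →L[ℝ] X)
    (B : KernelSpace Q →L[ℝ] KernelSpace Q) : Prop :=
  ∀ ξ : (dualAdjoint A).domain,
    inclusion Q (B (inclusionAdj Q ξ)) = Qinf (dualAdjoint A ξ)

open scoped Classical in
/-- The bounded operator `B` on `H` with `B i* ξ = Q_∞ A* ξ` for all `ξ ∈ D(A*)`. It exists when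
`DriftBound` holds, and is unique since `i* D(A*)` is dense in `H` (`A` being a generator). -/
def driftOperator (Q : NonnegSymmOp X) (A : X →ₗ.[ℝ] X) (Qinf : StrongDual ℝ X →L[ℝ] X) :
    KernelSpace Q →L[ℝ] KernelSpace Q :=
  if h : ∃ B, IsDriftOperator Q A Qinf B then h.choose else 0

/-- The bilinear form `-∫ [C D_H u, D_H v]_H dν` on `W^{1,2}_H(X, ν)`. -/
def form (Q : NonnegSymmOp X) (ν : Measure X) (C : KernelSpace Q →L[ℝ] KernelSpace Q)
    (u v : sobolev Q 2 ν) : ℝ :=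
  -∫ x, ⟪C (sobolevGradient Q 2 ν u x), sobolevGradient Q 2 ν v x⟫_ℝ ∂ν

theorem form_eq_inner (Q : NonnegSymmOp X) (ν : Measure X)
    (C : KernelSpace Q →L[ℝ] KernelSpace Q) (u v : sobolev Q 2 ν) :
    form Q ν C u v =
      -⟪C.compLpL 2 ν (sobolevGradient Q 2 ν u), sobolevGradient Q 2 ν v⟫_ℝ := by
  rw [form, L2.inner_def]
  congr 1
  refine integral_congr_ae ?_
  filter_upwards [C.coeFn_compLpL (p := 2) (μ := ν) (sobolevGradient Q 2 ν u)] with x hx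
  rw [hx]

/-- The graph of the operator associated with the form: pairs `(u, g)` with `u ∈ W^{1,2}_H(X, ν)`,
`g ∈ L²(X, ν)` such that `-∫ [C D_H u, D_H v]_H dν = -∫ g v dν` for all cylindrical `C_b^1`
functions `v`. -/
def formGraph (Q : NonnegSymmOp X) (ν : Measure X) (C : KernelSpace Q →L[ℝ] KernelSpace Q) :
    Submodule ℝ (Lp ℝ 2 ν × Lp ℝ 2 ν) where
  carrier := {w | ∃ u : sobolev Q 2 ν, (u : Lp ℝ 2 ν) = w.1 ∧
    ∀ v : sobolev Q 2 ν, (∃ f : X → ℝ, IsCylindrical f ∧ (v : Lp ℝ 2 ν) =ᵐ[ν] f) →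
      form Q ν C u v = -∫ x, w.2 x * (v : Lp ℝ 2 ν) x ∂ν}
  zero_mem' := by
    refine ⟨0, rfl, fun v _ => ?_⟩
    have key (g : Lp ℝ 2 ν) : ∫ x, g x * (v : Lp ℝ 2 ν) x ∂ν = ⟪(v : Lp ℝ 2 ν), g⟫_ℝ := by
      rw [L2.inner_def]; rfl
    rw [key, form_eq_inner, map_zero, map_zero, inner_zero_left, Prod.snd_zero, inner_zero_right]
  add_mem' := by
    rintro a b ⟨u, hu, h⟩ ⟨u', hu', h'⟩
    refine ⟨u + u', by simp [hu, hu'], fun v hv => ?_⟩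
    have key (g : Lp ℝ 2 ν) : ∫ x, g x * (v : Lp ℝ 2 ν) x ∂ν = ⟪(v : Lp ℝ 2 ν), g⟫_ℝ := by
      rw [L2.inner_def]; rfl
    have h1 := h v hv
    have h2 := h' v hv
    rw [key, form_eq_inner] at h1 h2 ⊢
    rw [map_add, map_add, inner_add_left, Prod.snd_add, inner_add_right]
    linarith
  smul_mem' := by
    rintro c a ⟨u, hu, h⟩
    refine ⟨c • u, by simp [hu], fun v hv => ?_⟩
    have key (g : Lp ℝ 2 ν) : ∫ x, g x * (v : Lp ℝ 2 ν) x ∂ν = ⟪(v : Lp ℝ 2 ν), g⟫_ℝ := by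
      rw [L2.inner_def]; rfl
    have h1 := h v hv
    rw [key, form_eq_inner] at h1 ⊢
    rw [map_smul, map_smul, real_inner_smul_left, Prod.smul_snd, real_inner_smul_right]
    linear_combination c * h1

/-- The unbounded operator on `L²(X, ν)` associated with the form `-∫ [C D_H u, D_H v]_H dν`. -/
def formOperator (Q : NonnegSymmOp X) (ν : Measure X) (C : KernelSpace Q →L[ℝ] KernelSpace Q) :
    Lp ℝ 2 ν →ₗ.[ℝ] Lp ℝ 2 ν :=
  (formGraph Q ν C).toLinearPMap

end Main

end

end OrnsteinUhlenbeck

namespace OrnsteinUhlenbeck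

noncomputable section

/-! ### Generation of contraction semigroups on real Hilbert spaces -/

section Generation

variable {K : Type*} [NormedAddCommGroup K] [InnerProductSpace ℝ K]

/-! The form has a half-identity symmetric part. Letting `s → ∞` in `Q_{t+s} = Q_t + S_t Q_s S_t*`
gives `Q_∞ = Q_t + S_t Q_∞ S_t*`, and its derivative at `t = 0` is the Lyapunov equation `lyapunov`.
In `H` this reads `[B h, h] = -|h|²/2` (`inner_driftOperator_self`). Hence the bounded form `[B D_H
u, D_H v]` controls the gradient norm, with constant `1/2`.

The analytic input is that `D_H` is closable in `L²(ν)` (`closable_gradientGraph`). Rotation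
invariance of `μ ⊗ μ` gives integration by parts for `μ` along the directions `Q_∞ η`
(`IsCenteredGaussian.integral_fderiv`). The formula is transferred to the weight `e^{-U}` using the
gradient of `U`, with `e^{-U} ∈ L²(μ)` because a proper lower semicontinuous convex function has an
affine minorant and Gaussian functionals have exponential moments. The directions `B i* ξ = Q_∞ A*
ξ`, `ξ ∈ D(A*)`, lie in `H` and are total there, because a vector `k` orthogonal to the range of `B`
satisfies `0 = [B k, k] = -|k|²/2`.

The graph of the closed gradient is then a Hilbert space on which Lax-Milgram solves `r u - L u = g`
for every `r > 0`. So the operators of `B` and `B*` are densely defined and maximal dissipative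
(`isMaximalDissipative_coerciveFormGraph`), and Yosida approximation yields their contraction
semigroups. Testing each equation with the other solution shows that the two operators are formally
adjoint. Between maximal dissipative operators formal adjointness is adjointness (`eq_adjoint`), and
it passes through resolvents and exponentials to the semigroups (`adjoint_semigroup`). -/

theorem hasDerivAt_exp_apply [CompleteSpace K] (A : K →L[ℝ] K) (x : K) (t : ℝ) :
    HasDerivAt (fun s : ℝ => NormedSpace.exp (s • A) x) (NormedSpace.exp (t • A) (A x)) t :=
  (hasDerivAt_exp_smul_const A t).clm_apply (hasDerivAt_const t x) |>.congr_deriv (by simp)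

theorem hasDerivAt_exp_apply' [CompleteSpace K] (A : K →L[ℝ] K) (x : K) (t : ℝ) :
    HasDerivAt (fun s : ℝ => NormedSpace.exp (s • A) x) (A (NormedSpace.exp (t • A) x)) t :=
  (hasDerivAt_exp_smul_const' A t).clm_apply (hasDerivAt_const t x) |>.congr_deriv (by simp)

/-- The exponential of a bounded dissipative operator is a contraction. -/
theorem norm_exp_apply_le [CompleteSpace K] {A : K →L[ℝ] K} (hA : ∀ x, ⟪x, A x⟫_ℝ ≤ 0) {t : ℝ}
    (ht : 0 ≤ t) (x : K) : ‖NormedSpace.exp (t • A) x‖ ≤ ‖x‖ := by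
  have hd (s : ℝ) := (hasDerivAt_exp_apply' A x s).norm_sq
  have hanti : Antitone fun s : ℝ => ‖NormedSpace.exp (s • A) x‖ ^ 2 := by
    refine antitone_of_deriv_nonpos (fun s => (hd s).differentiableAt) fun s => ?_
    rw [(hd s).deriv]
    linarith [hA (NormedSpace.exp (s • A) x)]
  have h0 := hanti ht
  simp only [zero_smul, NormedSpace.exp_zero, one_apply_eq_self] at h0
  exact abs_le_of_sq_le_sq h0 (norm_nonneg _) |> (le_abs_self _).trans

/-- The path `s ↦ e^{sA} e^{(t-s)A'} x` joins the two exponentials. Since `A` and `A'` commute, its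
derivative is a product of contractions applied to `A x - A' x`. -/
theorem norm_exp_apply_sub_exp_apply_le [CompleteSpace K] {A A' : K →L[ℝ] K}
    (hA : ∀ x, ⟪x, A x⟫_ℝ ≤ 0) (hA' : ∀ x, ⟪x, A' x⟫_ℝ ≤ 0) (hc : Commute A A') {t : ℝ}
    (ht : 0 ≤ t) (x : K) :
    ‖NormedSpace.exp (t • A) x - NormedSpace.exp (t • A') x‖ ≤ t * ‖A x - A' x‖ := by
  have hd (s : ℝ) : HasDerivAt
      (fun s : ℝ => NormedSpace.exp (s • A) (NormedSpace.exp ((t - s) • A') x))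
      (NormedSpace.exp (s • A) (NormedSpace.exp ((t - s) • A') (A x - A' x))) s := by
    have h1 : HasDerivAt (fun s : ℝ => NormedSpace.exp ((t - s) • A') x)
        (-(NormedSpace.exp ((t - s) • A') (A' x))) s := by
      have := (hasDerivAt_exp_apply A' x (t - s)).scomp s ((hasDerivAt_id s).const_sub t)
      rwa [neg_one_smul] at this
    refine ((hasDerivAt_exp_smul_const A s).clm_apply h1).congr_deriv ?_
    have hcomm : A (NormedSpace.exp ((t - s) • A') x) = NormedSpace.exp ((t - s) • A') (A x) := by
      have := ((hc.smul_right (t - s)).exp_right).eq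
      exact congr($this x)
    change NormedSpace.exp (s • A) (A (NormedSpace.exp ((t - s) • A') x)) + _ = _
    rw [hcomm, map_neg, map_sub, map_sub]
    exact (sub_eq_add_neg _ _).symm
  have := norm_image_sub_le_of_norm_deriv_le_segment' (a := 0) (b := t) (C := ‖A x - A' x‖)
    (fun s _ => (hd s).hasDerivWithinAt) (fun s hs => ?_) t ⟨ht, le_rfl⟩
  · simpa [mul_comm] using this
  · exact (norm_exp_apply_le hA hs.1 _).trans (norm_exp_apply_le hA' (by linarith [hs.2]) _)

theorem norm_exp_apply_sub_self_le [CompleteSpace K] {A : K →L[ℝ] K} (hA : ∀ x, ⟪x, A x⟫_ℝ ≤ 0)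
    {t : ℝ} (ht : 0 ≤ t) (x : K) : ‖NormedSpace.exp (t • A) x - x‖ ≤ t * ‖A x‖ := by
  simpa using norm_exp_apply_sub_exp_apply_le (A' := 0) hA (by simp) (Commute.zero_right A) ht x

/-- First-order Taylor remainder in a form that survives the Yosida limit: there `A x` converges but
`A (A x)` need not stay bounded. So `A x` is replaced by a nearby `y` for which `A y` is controlled.
-/
theorem norm_exp_apply_sub_sub_le [CompleteSpace K] {A : K →L[ℝ] K} (hA : ∀ x, ⟪x, A x⟫_ℝ ≤ 0)
    {t : ℝ} (ht : 0 ≤ t) (x y : K) :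
    ‖NormedSpace.exp (t • A) x - x - t • A x‖ ≤ t * (2 * ‖A x - y‖ + t * ‖A y‖) := by
  have hd (s : ℝ) : HasDerivAt (fun s : ℝ => NormedSpace.exp (s • A) x - s • A x)
      (NormedSpace.exp (s • A) (A x) - A x) s := by
    have := (hasDerivAt_exp_apply A x s).sub ((hasDerivAt_id s).smul_const (A x))
    rwa [one_smul] at this
  have := norm_image_sub_le_of_norm_deriv_le_segment' (a := 0) (b := t)
    (C := 2 * ‖A x - y‖ + t * ‖A y‖)
    (fun s _ => (hd s).hasDerivWithinAt) (fun s hs => ?_) t ⟨ht, le_rfl⟩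
  · simpa [mul_comm, sub_right_comm] using this
  · have h1 := norm_exp_apply_le hA hs.1 (A x - y)
    have h2 := norm_exp_apply_sub_self_le hA hs.1 y
    have h3 : s * ‖A y‖ ≤ t * ‖A y‖ := by gcongr; exact hs.2.le
    calc ‖NormedSpace.exp (s • A) (A x) - A x‖
        = ‖NormedSpace.exp (s • A) (A x - y) - (A x - y) + (NormedSpace.exp (s • A) y - y)‖ := by
          rw [map_sub]; congr 1; abel
      _ ≤ ‖NormedSpace.exp (s • A) (A x - y)‖ + ‖A x - y‖ + ‖NormedSpace.exp (s • A) y - y‖ :=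
          (norm_add_le _ _).trans (by gcongr; exact norm_sub_le _ _)
      _ ≤ _ := by linarith

/-- The graph of a densely defined maximal dissipative operator. -/
structure IsMaximalDissipative (Γ : Submodule ℝ (K × K)) : Prop where
  nonpos : ∀ w ∈ Γ, ⟪w.1, w.2⟫_ℝ ≤ 0
  surj : ∀ r : ℝ, 0 < r → ∀ g : K, ∃ u, (u, r • u - g) ∈ Γ
  dense : Dense (Prod.fst '' (Γ : Set (K × K)))

/-! ### Resolvents, Yosida approximations and formal adjoints. -/

namespace IsMaximalDissipative

variable {Γ Γ' : Submodule ℝ (K × K)}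

theorem mul_norm_le (h : IsMaximalDissipative Γ) {r : ℝ} {u g : K}
    (hu : (u, r • u - g) ∈ Γ) : r * ‖u‖ ≤ ‖g‖ := by
  have h1 := h.nonpos _ hu
  simp only [inner_sub_right, real_inner_smul_right, real_inner_self_eq_norm_sq] at h1
  have h2 := real_inner_le_norm u g
  rcases (norm_nonneg u).eq_or_lt with h0 | h0
  · rw [← h0, mul_zero]; positivity
  · refine le_of_mul_le_mul_left ?_ h0
    linarith

theorem eq_of_mem (h : IsMaximalDissipative Γ) {r : ℝ} (hr : 0 < r) {u u' g : K}
    (hu : (u, r • u - g) ∈ Γ) (hu' : (u', r • u' - g) ∈ Γ) : u = u' := by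
  have h1 : (u - u', r • (u - u') - 0) ∈ Γ := by
    convert Γ.sub_mem hu hu' using 1
    ext <;> simp [smul_sub]
  have h2 := h.mul_norm_le h1
  rw [norm_zero] at h2
  have h3 : ‖u - u'‖ ≤ 0 := by
    by_contra! h0
    linarith [mul_pos hr h0]
  exact sub_eq_zero.1 (norm_le_zero_iff.1 h3)

open scoped Classical in
/-- The resolvent `(r - L)⁻¹` of the operator `L` with graph `Γ`, for `r > 0`. -/
def resolvent (h : IsMaximalDissipative Γ) (r : ℝ) (hr : 0 < r) : K →L[ℝ] K :=
  LinearMap.mkContinuous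
    { toFun := fun g => (h.surj r hr g).choose
      map_add' := fun a b => by
        refine h.eq_of_mem hr (h.surj r hr (a + b)).choose_spec ?_
        convert Γ.add_mem (h.surj r hr a).choose_spec (h.surj r hr b).choose_spec using 1
        ext
        · rfl
        · simp only [smul_add, Prod.snd_add]; abel
      map_smul' := fun c a => by
        refine h.eq_of_mem hr (h.surj r hr (c • a)).choose_spec ?_
        convert Γ.smul_mem c (h.surj r hr a).choose_spec using 1
        ext
        · rfl
        · simp [smul_sub, smul_comm c r] }
    r⁻¹ fun g => by
      rw [inv_mul_eq_div, le_div_iff₀ hr, mul_comm]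
      exact h.mul_norm_le (h.surj r hr g).choose_spec

theorem resolvent_mem (h : IsMaximalDissipative Γ) {r : ℝ} (hr : 0 < r) (g : K) :
    (h.resolvent r hr g, r • h.resolvent r hr g - g) ∈ Γ :=
  (h.surj r hr g).choose_spec

theorem resolvent_eq (h : IsMaximalDissipative Γ) {r : ℝ} (hr : 0 < r) {u g : K}
    (hu : (u, r • u - g) ∈ Γ) : h.resolvent r hr g = u :=
  h.eq_of_mem hr (h.resolvent_mem hr g) hu

/-- The Yosida approximation `r (r (r - L)⁻¹ - 1)`. -/
def yosida (h : IsMaximalDissipative Γ) (r : ℝ) (hr : 0 < r) : K →L[ℝ] K :=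
  r • (r • h.resolvent r hr - 1)

theorem yosida_apply (h : IsMaximalDissipative Γ) {r : ℝ} (hr : 0 < r) (x : K) :
    h.yosida r hr x = r • (r • h.resolvent r hr x - x) := rfl

theorem norm_smul_resolvent_le (h : IsMaximalDissipative Γ) {r : ℝ} (hr : 0 < r) (x : K) :
    ‖r • h.resolvent r hr x‖ ≤ ‖x‖ := by
  rw [norm_smul, Real.norm_of_nonneg hr.le]
  exact h.mul_norm_le (h.resolvent_mem hr x)

theorem inner_yosida_nonpos (h : IsMaximalDissipative Γ) {r : ℝ} (hr : 0 < r) (x : K) :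
    ⟪x, h.yosida r hr x⟫_ℝ ≤ 0 := by
  rw [yosida_apply, real_inner_smul_right, inner_sub_right, real_inner_self_eq_norm_sq]
  have h1 := real_inner_le_norm x (r • h.resolvent r hr x)
  have h2 := mul_le_mul_of_nonneg_left (h.norm_smul_resolvent_le hr x) (norm_nonneg x)
  exact mul_nonpos_of_nonneg_of_nonpos hr.le (by nlinarith)

/-- Both orders of composition are read off from the resolvent identity `(s - r) R_r R_s = R_r -
R_s`, used for `(r, s)` and for `(s, r)`. -/
theorem resolvent_comm (h : IsMaximalDissipative Γ) {r s : ℝ} (hr : 0 < r) (hs : 0 < s) (x : K) :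
    h.resolvent r hr (h.resolvent s hs x) = h.resolvent s hs (h.resolvent r hr x) := by
  by_cases hrs : r = s
  · subst hrs; rfl
  have key : ∀ {r s : ℝ} (hr : 0 < r) (hs : 0 < s), 
      (s - r) • h.resolvent r hr (h.resolvent s hs x) =
        h.resolvent r hr x - h.resolvent s hs x := by
    intro r s hr hs
    rw [← map_smul]
    refine h.resolvent_eq hr ?_
    convert Γ.sub_mem (h.resolvent_mem hr x) (h.resolvent_mem hs x) using 1
    ext
    · rfl
    · simp only [smul_sub, sub_smul, Prod.snd_sub]; abel
  have h1 := key hr hs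
  have h2 := key hs hr
  have h3 : (s - r) • h.resolvent r hr (h.resolvent s hs x) =
      (s - r) • h.resolvent s hs (h.resolvent r hr x) := by
    rw [h1, ← neg_sub r s, neg_smul, h2, neg_sub]
  exact smul_right_injective K (sub_ne_zero.2 (Ne.symm hrs)) h3

theorem commute_yosida (h : IsMaximalDissipative Γ) {r s : ℝ} (hr : 0 < r) (hs : 0 < s) :
    Commute (h.yosida r hr) (h.yosida s hs) := by
  have : Commute (h.resolvent r hr) (h.resolvent s hs) :=
    ContinuousLinearMap.ext fun x => h.resolvent_comm hr hs x
  refine (Commute.smul_left (Commute.smul_right ?_ _) _)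
  exact ((this.smul_left r).smul_right s |>.sub_right (Commute.one_right _)).sub_left
    (Commute.one_left _)

/-- On the domain the approximation is `r R_r L x`, so its convergence to `L x` reduces to the
strong convergence `r R_r → 1`. -/
theorem yosida_of_mem (h : IsMaximalDissipative Γ) {r : ℝ} (hr : 0 < r) {x y : K}
    (hxy : (x, y) ∈ Γ) : h.yosida r hr x = r • h.resolvent r hr y := by
  have h1 : h.resolvent r hr (r • x - y) = x := h.resolvent_eq hr (by simpa using hxy)
  rw [map_sub, map_smul, sub_eq_iff_eq_add] at h1
  rw [yosida_apply, h1, add_sub_cancel_left]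

/-- The sequence of Yosida approximations. -/
def approx (h : IsMaximalDissipative Γ) (n : ℕ) : K →L[ℝ] K :=
  h.yosida (n + 1) n.cast_add_one_pos

/-- On the domain `r R_r y - y = R_r (L y)` has norm at most `‖L y‖ / r`. The contractions `r R_r`
extend the convergence to the closure of the domain. -/
theorem tendsto_smul_resolvent (h : IsMaximalDissipative Γ) (x : K) :
    Tendsto (fun n : ℕ => ((n : ℝ) + 1) • h.resolvent (n + 1) n.cast_add_one_pos x) atTop
      (𝓝 x) := by
  rw [Metric.tendsto_atTop]
  intro ε hε
  obtain ⟨_, hy, ⟨⟨y, z⟩, hyz, rfl⟩⟩ := Metric.dense_iff.1 h.dense x (ε / 3) (by positivity)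
  obtain ⟨N, hN⟩ := exists_nat_gt (‖z‖ / (ε / 3))
  refine ⟨N, fun n hn => ?_⟩
  have hn0 : (0 : ℝ) < n + 1 := n.cast_add_one_pos
  set R := h.resolvent (n + 1) hn0
  have h1 : ‖R z‖ < ε / 3 := by
    have := h.mul_norm_le (h.resolvent_mem hn0 z)
    rw [div_lt_iff₀ (by positivity)] at hN
    have h2 : ((N : ℝ)) < n + 1 := by exact_mod_cast Nat.lt_succ_of_le hn
    by_contra! h3
    have := mul_le_mul h2.le h3 (by positivity) hn0.le
    linarith
  have h2 : ((n : ℝ) + 1) • R y - y = R z := by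
    have h1 : R (((n : ℝ) + 1) • y - z) = y := h.resolvent_eq hn0 (by simpa using hyz)
    rw [map_sub, map_smul, sub_eq_iff_eq_add] at h1
    rw [h1, add_sub_cancel_left]
  have h3 := h.norm_smul_resolvent_le hn0 (x - y)
  rw [Metric.mem_ball, dist_eq_norm, norm_sub_rev] at hy
  rw [dist_eq_norm]
  calc ‖((n : ℝ) + 1) • R x - x‖
      = ‖((n : ℝ) + 1) • R (x - y) + (((n : ℝ) + 1) • R y - y) - (x - y)‖ := by
        rw [map_sub, smul_sub]; congr 1; abel
    _ ≤ ‖((n : ℝ) + 1) • R (x - y)‖ + ‖((n : ℝ) + 1) • R y - y‖ + ‖x - y‖ :=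
        (norm_sub_le _ _).trans (by gcongr; exact norm_add_le _ _)
    _ < ε := by rw [h2]; linarith

theorem tendsto_approx (h : IsMaximalDissipative Γ) {x y : K} (hxy : (x, y) ∈ Γ) :
    Tendsto (fun n => h.approx n x) atTop (𝓝 y) :=
  (h.tendsto_smul_resolvent y).congr fun _ => (h.yosida_of_mem _ hxy).symm

/-- Let `(v, w)` belong to the adjoint of `Γ`, and let `v'` solve `v' - L' v' = v - w`. Then `v -
v'` is orthogonal to the range of `1 - L`, which is the whole space, so `v = v'` and `(v, w) ∈ Γ'`.
-/
theorem eq_adjoint (h : IsMaximalDissipative Γ) (h' : IsMaximalDissipative Γ')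
    (hadj : ∀ w ∈ Γ, ∀ w' ∈ Γ', ⟪w.2, w'.1⟫_ℝ = ⟪w.1, w'.2⟫_ℝ) : Γ' = Γ.adjoint := by
  ext ⟨v, w⟩
  rw [Submodule.mem_adjoint_iff]
  refine ⟨fun hv a b hab => ?_, fun hv => ?_⟩
  · rw [sub_eq_zero]
    exact hadj _ hab _ hv
  · obtain ⟨v', hv'⟩ := h'.surj 1 one_pos (v - w)
    have h1 : v = v' := by
      refine ext_inner_left ℝ fun g => ?_
      obtain ⟨u, hu⟩ := h.surj 1 one_pos g
      have h2 := hv _ _ hu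
      have h3 := hadj _ hu _ hv'
      simp only [inner_sub_left, inner_sub_right, one_smul] at h2 h3
      linarith
    rwa [one_smul, ← h1, sub_sub_cancel] at hv'

/-- `Γ` is single-valued because the Yosida approximations at `x.1` converge to `x.2`, and they
vanish at `0`. -/
theorem eq_zero_of_mem (h : IsMaximalDissipative Γ) {x : K × K} (hx : x ∈ Γ) (hx0 : x.1 = 0) :
    x.2 = 0 := by
  obtain ⟨x, y⟩ := x
  obtain rfl : x = 0 := hx0
  have h1 := h.tendsto_approx hx
  simp only [map_zero] at h1
  exact tendsto_nhds_unique h1 tendsto_const_nhds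

theorem graph_toLinearPMap (h : IsMaximalDissipative Γ) : Γ.toLinearPMap.graph = Γ :=
  Submodule.toLinearPMap_graph_eq _ fun _ hx hx0 => h.eq_zero_of_mem hx hx0

/-! ### The semigroup as a limit of exponentials, its generator and its adjoint. -/

variable [CompleteSpace K]

/-- For `y` in the domain, two exponentials differ at `y` by at most `t ‖A_m y - A_n y‖`, which
tends to `0`. Contractivity carries this over to `x` by density. -/
theorem cauchySeq_exp_approx (h : IsMaximalDissipative Γ) {t : ℝ} (ht : 0 ≤ t) (x : K) :
    CauchySeq fun n => NormedSpace.exp (t • h.approx n) x := by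
  rw [Metric.cauchySeq_iff]
  intro ε hε
  obtain ⟨_, hy, ⟨⟨y, z⟩, hyz, rfl⟩⟩ := Metric.dense_iff.1 h.dense x (ε / 3) (by positivity)
  have hz := ((h.tendsto_approx hyz).const_smul t).cauchySeq
  rw [Metric.cauchySeq_iff] at hz
  obtain ⟨N, hN⟩ := hz (ε / 3) (by positivity)
  refine ⟨N, fun m hm n hn => ?_⟩
  have h1 := hN m hm n hn
  rw [dist_eq_norm, ← smul_sub, norm_smul, Real.norm_of_nonneg ht] at h1
  have h2 := norm_exp_apply_sub_exp_apply_le (h.inner_yosida_nonpos m.cast_add_one_pos)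
    (h.inner_yosida_nonpos n.cast_add_one_pos) (h.commute_yosida _ _) ht y
  have h3 := norm_exp_apply_le (h.inner_yosida_nonpos m.cast_add_one_pos) ht (x - y)
  have h4 := norm_exp_apply_le (h.inner_yosida_nonpos n.cast_add_one_pos) ht (x - y)
  rw [Metric.mem_ball, dist_eq_norm, norm_sub_rev] at hy
  rw [dist_eq_norm]
  change ‖NormedSpace.exp (t • h.approx m) (x - y)‖ ≤ _ at h3
  change ‖NormedSpace.exp (t • h.approx n) (x - y)‖ ≤ _ at h4
  change ‖NormedSpace.exp (t • h.approx m) y - NormedSpace.exp (t • h.approx n) y‖ ≤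
    t * ‖h.approx m y - h.approx n y‖ at h2
  calc ‖NormedSpace.exp (t • h.approx m) x - NormedSpace.exp (t • h.approx n) x‖
      = ‖NormedSpace.exp (t • h.approx m) (x - y) - NormedSpace.exp (t • h.approx n) (x - y) +
          (NormedSpace.exp (t • h.approx m) y - NormedSpace.exp (t • h.approx n) y)‖ := by
        simp only [map_sub]; congr 1; abel
    _ ≤ ‖NormedSpace.exp (t • h.approx m) (x - y)‖ + ‖NormedSpace.exp (t • h.approx n) (x - y)‖ +
          ‖NormedSpace.exp (t • h.approx m) y - NormedSpace.exp (t • h.approx n) y‖ :=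
        (norm_add_le _ _).trans (by gcongr; exact norm_sub_le _ _)
    _ < ε := by linarith

/-- The semigroup generated by the operator with graph `Γ`. -/
def semigroup (h : IsMaximalDissipative Γ) (t : ℝ≥0) : K →L[ℝ] K :=
  continuousLinearMapOfTendsto (σ₁₂ := RingHom.id ℝ)
    (fun n => NormedSpace.exp ((t : ℝ) • h.approx n))
    (f := fun x => (cauchySeq_tendsto_of_complete (h.cauchySeq_exp_approx t.2 x)).choose)
    (tendsto_pi_nhds.2 fun x =>
      (cauchySeq_tendsto_of_complete (h.cauchySeq_exp_approx t.2 x)).choose_spec)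

theorem tendsto_semigroup (h : IsMaximalDissipative Γ) (t : ℝ≥0) (x : K) :
    Tendsto (fun n => NormedSpace.exp ((t : ℝ) • h.approx n) x) atTop (𝓝 (h.semigroup t x)) :=
  (cauchySeq_tendsto_of_complete (h.cauchySeq_exp_approx t.2 x)).choose_spec

theorem norm_semigroup_apply_le (h : IsMaximalDissipative Γ) (t : ℝ≥0) (x : K) :
    ‖h.semigroup t x‖ ≤ ‖x‖ :=
  le_of_tendsto (h.tendsto_semigroup t x).norm <| Eventually.of_forall fun n =>
    norm_exp_apply_le (h.inner_yosida_nonpos n.cast_add_one_pos) t.2 x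

theorem norm_semigroup_sub_le (h : IsMaximalDissipative Γ) (t : ℝ≥0) {x y : K}
    (hxy : (x, y) ∈ Γ) : ‖h.semigroup t x - x‖ ≤ t * ‖y‖ :=
  le_of_tendsto_of_tendsto' ((h.tendsto_semigroup t x).sub_const x).norm
    ((h.tendsto_approx hxy).norm.const_mul (t : ℝ)) fun n =>
    norm_exp_apply_sub_self_le (h.inner_yosida_nonpos n.cast_add_one_pos) t.2 x

theorem norm_semigroup_sub_sub_le (h : IsMaximalDissipative Γ) (t : ℝ≥0) {x y y' z : K}
    (hxy : (x, y) ∈ Γ) (hyz : (y', z) ∈ Γ) :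
    ‖h.semigroup t x - x - (t : ℝ) • y‖ ≤ t * (2 * ‖y - y'‖ + t * ‖z‖) :=
  le_of_tendsto_of_tendsto'
    (((h.tendsto_semigroup t x).sub_const x).sub ((h.tendsto_approx hxy).const_smul (t : ℝ))).norm
    (((((h.tendsto_approx hxy).sub_const y').norm.const_mul 2).add
      ((h.tendsto_approx hyz).norm.const_mul (t : ℝ))).const_mul (t : ℝ)) fun n =>
    norm_exp_apply_sub_sub_le (h.inner_yosida_nonpos n.cast_add_one_pos) t.2 x y'

theorem isContractionSemigroup (h : IsMaximalDissipative Γ) :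
    IsContractionSemigroup h.semigroup where
  zero := by
    ext x
    exact tendsto_nhds_unique (h.tendsto_semigroup 0 x) (by simp)
  add s t := by
    ext x
    refine tendsto_nhds_unique (h.tendsto_semigroup (s + t) x) ?_
    have h1 (n : ℕ) : NormedSpace.exp (((s + t : ℝ≥0) : ℝ) • h.approx n) x =
        NormedSpace.exp ((s : ℝ) • h.approx n) (NormedSpace.exp ((t : ℝ) • h.approx n) x) := by
      let _ : NormedAlgebra ℚ (K →L[ℝ] K) := NormedAlgebra.restrictScalars ℚ ℝ _
      rw [NNReal.coe_add, add_smul, NormedSpace.exp_add_of_commute]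
      · rfl
      · exact (Commute.refl _).smul_left _ |>.smul_right _
    simp_rw [h1]
    rw [tendsto_iff_norm_sub_tendsto_zero]
    have h2 := (tendsto_iff_norm_sub_tendsto_zero.1 (h.tendsto_semigroup t x)).add
      (tendsto_iff_norm_sub_tendsto_zero.1 (h.tendsto_semigroup s (h.semigroup t x)))
    rw [add_zero] at h2
    refine squeeze_zero (fun _ => norm_nonneg _) (fun n => ?_) h2
    refine (norm_sub_le_norm_sub_add_norm_sub _
      (NormedSpace.exp ((s : ℝ) • h.approx n) (h.semigroup t x)) _).trans ?_
    rw [← map_sub]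
    exact add_le_add_left (norm_exp_apply_le (h.inner_yosida_nonpos n.cast_add_one_pos) s.2 _) _
  contraction t := ContinuousLinearMap.opNorm_le_bound _ zero_le_one fun x => by
    simpa using h.norm_semigroup_apply_le t x
  strong x := by
    rw [Metric.tendsto_nhds]
    intro ε hε
    obtain ⟨_, hy, ⟨⟨y, z⟩, hyz, rfl⟩⟩ := Metric.dense_iff.1 h.dense x (ε / 3) (by positivity)
    rw [Metric.mem_ball, dist_eq_norm, norm_sub_rev] at hy
    have h1 : Tendsto (fun t : ℝ≥0 => (t : ℝ) * ‖z‖) (𝓝 0) (𝓝 0) := by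
      have : Continuous fun t : ℝ≥0 => (t : ℝ) * ‖z‖ := by fun_prop
      simpa using this.tendsto 0
    filter_upwards [h1.eventually_lt_const (show 0 < ε / 3 by positivity)] with t ht
    have h2 := h.norm_semigroup_sub_le t hyz
    have h3 := h.norm_semigroup_apply_le t (x - y)
    rw [dist_eq_norm]
    calc ‖h.semigroup t x - x‖
        = ‖h.semigroup t (x - y) + (h.semigroup t y - y) - (x - y)‖ := by
          rw [map_sub]; congr 1; abel
      _ ≤ ‖h.semigroup t (x - y)‖ + ‖h.semigroup t y - y‖ + ‖x - y‖ :=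
          (norm_sub_le _ _).trans (by gcongr; exact norm_add_le _ _)
      _ < ε := by linarith

theorem le_generatorGraph (h : IsMaximalDissipative Γ) : Γ ≤ generatorGraph h.semigroup := by
  rintro ⟨x, y⟩ hxy
  change Tendsto _ _ _
  rw [Metric.tendsto_nhds]
  intro ε hε
  -- `y = L x` need not lie in the domain, so the remainder estimate is used with a domain element
  -- `y'` close to `y`. Divided by `t`, it is at most `2 ‖y - y'‖ + t ‖z‖`.
  obtain ⟨_, hy, ⟨⟨y', z⟩, hyz, rfl⟩⟩ := Metric.dense_iff.1 h.dense y (ε / 3) (by positivity)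
  rw [Metric.mem_ball, dist_eq_norm, norm_sub_rev] at hy
  have h1 : Tendsto (fun t : ℝ≥0 => (t : ℝ) * ‖z‖) (𝓝[>] 0) (𝓝 0) := by
    have : Continuous fun t : ℝ≥0 => (t : ℝ) * ‖z‖ := by fun_prop
    exact (this.tendsto' 0 0 (by simp)).mono_left nhdsWithin_le_nhds
  filter_upwards [h1.eventually_lt_const (show 0 < ε / 3 by positivity), self_mem_nhdsWithin]
    with t ht ht0
  have ht0' : (0 : ℝ) < t := ht0
  have h2 := h.norm_semigroup_sub_sub_le t hxy hyz
  have h3 : (t : ℝ)⁻¹ • (h.semigroup t x - x) - y =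
      (t : ℝ)⁻¹ • (h.semigroup t x - x - (t : ℝ) • y) := by
    rw [smul_sub _ _ ((t : ℝ) • y), inv_smul_smul₀ ht0'.ne']
  rw [dist_eq_norm, h3, norm_smul, norm_inv, Real.norm_of_nonneg ht0'.le, inv_mul_eq_div,
    div_lt_iff₀ ht0']
  dsimp only at hy
  nlinarith

/-- The generator of a contraction semigroup is dissipative, and `Γ` admits no proper dissipative
extension because `1 - L` is onto. -/
theorem generatorGraph_semigroup (h : IsMaximalDissipative Γ) :
    generatorGraph h.semigroup = Γ := by
  refine le_antisymm ?_ h.le_generatorGraph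
  have hdiss : ∀ w ∈ generatorGraph h.semigroup, ⟪w.1, w.2⟫_ℝ ≤ 0 := by
    intro w hw
    have hw' : Tendsto (fun t : ℝ≥0 => (t : ℝ)⁻¹ • (h.semigroup t w.1 - w.1)) (𝓝[>] 0)
      (𝓝 w.2) := hw
    refine le_of_tendsto (tendsto_const_nhds.inner (𝕜 := ℝ) (x := w.1) hw') (Eventually.of_forall fun t => ?_)
    rw [real_inner_smul_right, inner_sub_right, real_inner_self_eq_norm_sq]
    have h1 := real_inner_le_norm w.1 (h.semigroup t w.1)
    have h2 := mul_le_mul_of_nonneg_left (h.norm_semigroup_apply_le t w.1) (norm_nonneg w.1)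
    exact mul_nonpos_of_nonneg_of_nonpos (by positivity) (by nlinarith)
  rintro ⟨x, y⟩ hxy
  obtain ⟨u, hu⟩ := h.surj 1 one_pos (x - y)
  have h1 := hdiss _ (Submodule.sub_mem _ hxy (h.le_generatorGraph hu))
  have h2 : y - ((1 : ℝ) • u - (x - y)) = x - u := by rw [one_smul]; abel
  simp only [Prod.fst_sub, Prod.snd_sub, h2, real_inner_self_eq_norm_sq] at h1
  have h3 : x = u := by
    rw [← sub_eq_zero, ← norm_eq_zero]
    nlinarith [norm_nonneg (x - u)]
  rw [one_smul, ← h3, sub_sub_cancel] at hu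
  exact hu

theorem adjoint_resolvent (h : IsMaximalDissipative Γ) (h' : IsMaximalDissipative Γ')
    (hadj : ∀ w ∈ Γ, ∀ w' ∈ Γ', ⟪w.2, w'.1⟫_ℝ = ⟪w.1, w'.2⟫_ℝ) {r : ℝ} (hr : 0 < r) :
    ContinuousLinearMap.adjoint (h.resolvent r hr) = h'.resolvent r hr := by
  refine (ContinuousLinearMap.eq_adjoint_iff _ _).2 (fun x y => ?_) |>.symm
  have h1 := hadj _ (h.resolvent_mem hr y) _ (h'.resolvent_mem hr x)
  simp only [inner_sub_left, inner_sub_right, real_inner_smul_left, real_inner_smul_right] at h1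
  rw [real_inner_comm, real_inner_comm (h.resolvent r hr y) x]
  linarith

/-- Taking adjoints commutes with resolvents, Yosida approximations and exponentials. Strong limits
need not be preserved by it, so the limit is taken inside inner products. -/
theorem adjoint_semigroup (h : IsMaximalDissipative Γ) (h' : IsMaximalDissipative Γ')
    (hadj : ∀ w ∈ Γ, ∀ w' ∈ Γ', ⟪w.2, w'.1⟫_ℝ = ⟪w.1, w'.2⟫_ℝ) (t : ℝ≥0) :
    h'.semigroup t = ContinuousLinearMap.adjoint (h.semigroup t) := by
  refine (ContinuousLinearMap.eq_adjoint_iff _ _).2 fun x y => ?_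
  refine tendsto_nhds_unique ((h'.tendsto_semigroup t x).inner tendsto_const_nhds)
    ((tendsto_const_nhds.inner (h.tendsto_semigroup t y)).congr fun n => ?_)
  have h1 : h'.approx n = ContinuousLinearMap.adjoint (h.approx n) := by
    simp [approx, yosida, ← ContinuousLinearMap.star_eq_adjoint]
    simp [ContinuousLinearMap.star_eq_adjoint, h.adjoint_resolvent h' hadj]
  have h2 : NormedSpace.exp ((t : ℝ) • h'.approx n) =
      ContinuousLinearMap.adjoint (NormedSpace.exp ((t : ℝ) • h.approx n)) := by
    rw [h1, ← ContinuousLinearMap.star_eq_adjoint, ← ContinuousLinearMap.star_eq_adjoint,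
      NormedSpace.star_exp, star_smul, star_trivial (t : ℝ)]
  rw [h2, ContinuousLinearMap.adjoint_inner_left]

theorem adjoint_toLinearPMap (h : IsMaximalDissipative Γ) (h' : IsMaximalDissipative Γ')
    (hadj : ∀ w ∈ Γ, ∀ w' ∈ Γ', ⟪w.2, w'.1⟫_ℝ = ⟪w.1, w'.2⟫_ℝ) :
    Γ'.toLinearPMap = Γ.toLinearPMap.adjoint := by
  have hd : Dense (Γ.toLinearPMap.domain : Set K) := h.dense
  rw [← LinearPMap.graph_adjoint_toLinearPMap_eq_adjoint hd, h.graph_toLinearPMap,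
    ← h.eq_adjoint h' hadj]

end IsMaximalDissipative

end Generation

/-! ### Strongly continuous contraction semigroups on Banach spaces -/

section Banach

theorem tendsto_average_integral {E : Type*} [NormedAddCommGroup E] [NormedSpace ℝ E]
    [CompleteSpace E] {f : ℝ → E} (hf : Continuous f) (r : ℝ) :
    Tendsto (fun t : ℝ≥0 => (t : ℝ)⁻¹ • ∫ s in r..(r + t), f s) (𝓝[>] 0) (𝓝 (f r)) := by
  have h1 := (hasDerivAt_iff_tendsto_slope_zero.1
    (hf.integral_hasStrictDerivAt r r).hasDerivAt)
  simp only [intervalIntegral.integral_same, sub_zero] at h1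
  refine h1.comp (tendsto_nhdsWithin_iff.2 ⟨?_, ?_⟩)
  · exact (NNReal.continuous_coe.tendsto' 0 0 (by simp)).mono_left nhdsWithin_le_nhds
  · filter_upwards [self_mem_nhdsWithin] with t ht
    exact (NNReal.coe_pos.2 ht).ne'

/-- A bounded densely defined map with values in a space which embeds into `X` extends, provided
that it is linear as a map to `X`. -/
theorem exists_extension {E H X : Type*} [AddCommGroup E] [Module ℝ E] [NormedAddCommGroup H]
    [NormedSpace ℝ H] [CompleteSpace H] [AddCommGroup X] [Module ℝ X] (j : H →ₗ[ℝ] X)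
    (hj : Function.Injective j) (e : E →ₗ[ℝ] H) (he : DenseRange e) (g : E →ₗ[ℝ] X)
    (h : ∃ c > 0, ∀ x, ∃ y, j y = g x ∧ ‖y‖ ≤ c * ‖e x‖) :
    ∃ B : H →L[ℝ] H, ∀ x, j (B (e x)) = g x := by
  obtain ⟨c, -, hc⟩ := h
  choose f hf hfc using hc
  let F : E →ₗ[ℝ] H :=
    { toFun := f
      map_add' := fun a b => hj (by simp only [map_add, hf])
      map_smul' := fun r a => hj (by simp only [map_smul, hf, RingHom.id_apply]) }
  refine ⟨F.extendOfNorm e, fun x => ?_⟩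
  rw [LinearMap.extendOfNorm_eq (f := F) he ⟨c, hfc⟩]
  exact hf x

theorem exists_extension_inclusionAdj {X : Type*} [NormedAddCommGroup X] [NormedSpace ℝ X]
    [CompleteSpace X] (Q : NonnegSymmOp X) (D : Submodule ℝ (StrongDual ℝ X))
    (hD : DenseRange fun ξ : D => inclusionAdj Q ξ) (g : D →ₗ[ℝ] X)
    (h : ∃ c > 0, ∀ ξ : D, ∃ h : KernelSpace Q,
      inclusion Q h = g ξ ∧ ‖h‖ ≤ c * ‖inclusionAdj Q ξ‖) :
    ∃ B : KernelSpace Q →L[ℝ] KernelSpace Q,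
      ∀ ξ : D, inclusion Q (B (inclusionAdj Q ξ)) = g ξ := by
  let e : D →ₗ[ℝ] KernelSpace Q :=
    (inclusionAdj Q : StrongDual ℝ X →ₗ[ℝ] KernelSpace Q) ∘ₗ D.subtype
  let j := (inclusion Q : KernelSpace Q →ₗ[ℝ] X)
  have := exists_extension (E := D) (H := KernelSpace Q) (X := X) j (inclusion_injective Q) e hD g h
  exact this

namespace IsContractionSemigroup

variable {X : Type*} [NormedAddCommGroup X] [NormedSpace ℝ X] {S : ℝ≥0 → X →L[ℝ] X}

theorem norm_apply_le (hS : IsContractionSemigroup S) (t : ℝ≥0) (x : X) : ‖S t x‖ ≤ ‖x‖ :=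
  (S t).le_of_opNorm_le (hS.contraction t) x |>.trans_eq (one_mul _)

theorem add_apply (hS : IsContractionSemigroup S) (s t : ℝ≥0) (x : X) :
    S (s + t) x = S s (S t x) := by
  rw [hS.add]; rfl

theorem apply_comm (hS : IsContractionSemigroup S) (s t : ℝ≥0) (x : X) :
    S s (S t x) = S t (S s x) := by
  rw [← hS.add_apply, add_comm, hS.add_apply]

/-- For `s ≤ t` one has `S_t - S_s = S_s (S_{t-s} - 1)`, so strong continuity at `0` gives
continuity at every time, from both sides. -/
theorem norm_apply_sub_apply_le (hS : IsContractionSemigroup S) (s t : ℝ≥0) (x : X) :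
    ‖S t x - S s x‖ ≤ ‖S (nndist t s) x - x‖ := by
  wlog hst : s ≤ t generalizing s t
  · rw [norm_sub_rev, nndist_comm]
    exact this t s (le_of_not_ge hst)
  have h1 : nndist t s = t - s := by
    rw [NNReal.nndist_eq, tsub_eq_zero_of_le hst, max_eq_left zero_le]
  have h2 : S t x - S s x = S s (S (t - s) x - x) := by
    rw [map_sub, ← hS.add_apply, add_tsub_cancel_of_le hst]
  rw [h1, h2]
  exact hS.norm_apply_le _ _

theorem continuous_apply (hS : IsContractionSemigroup S) (x : X) : Continuous fun t => S t x := by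
  refine continuous_iff_continuousAt.2 fun s => ?_
  refine tendsto_iff_norm_sub_tendsto_zero.2 ?_
  refine squeeze_zero (fun _ => norm_nonneg _) (fun t => hS.norm_apply_sub_apply_le s t x) ?_
  have h1 : Tendsto (fun t : ℝ≥0 => nndist t s) (𝓝 s) (𝓝 0) := by
    have : Continuous fun t : ℝ≥0 => nndist t s := by fun_prop
    exact this.tendsto' _ _ (nndist_self s)
  exact tendsto_iff_norm_sub_tendsto_zero.1 ((hS.strong x).comp h1)

theorem tendsto_apply (hS : IsContractionSemigroup S) {α : Type*} {l : Filter α} {τ : α → ℝ≥0}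
    {y : α → X} {t : ℝ≥0} {x : X} (hτ : Tendsto τ l (𝓝 t)) (hy : Tendsto y l (𝓝 x)) :
    Tendsto (fun a => S (τ a) (y a)) l (𝓝 (S t x)) := by
  rw [tendsto_iff_norm_sub_tendsto_zero]
  have h1 := (tendsto_iff_norm_sub_tendsto_zero.1 hy).add
    (tendsto_iff_norm_sub_tendsto_zero.1 (((hS.continuous_apply x).tendsto t).comp hτ))
  rw [add_zero] at h1
  refine squeeze_zero (fun _ => norm_nonneg _) (fun a => ?_) h1
  refine (norm_sub_le_norm_sub_add_norm_sub _ (S (τ a) x) _).trans ?_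
  rw [← map_sub]
  exact add_le_add_left (hS.norm_apply_le _ _) _

theorem continuous_apply_toNNReal (hS : IsContractionSemigroup S) (x : X) :
    Continuous fun t : ℝ => S t.toNNReal x :=
  (hS.continuous_apply x).comp continuous_real_toNNReal

theorem map_mem_generatorGraph (hS : IsContractionSemigroup S) {w : X × X}
    (hw : w ∈ generatorGraph S) (t : ℝ≥0) : (S t w.1, S t w.2) ∈ generatorGraph S := by
  refine (((S t).continuous.tendsto _).comp hw).congr fun h => ?_
  simp only [Function.comp, map_smul, map_sub, hS.apply_comm h t]

/-- The integral `∫₀ᵗ S(s) x ds`. -/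
def integral (hS : IsContractionSemigroup S) (t : ℝ≥0) : X →L[ℝ] X :=
  LinearMap.mkContinuous
    { toFun := fun x => ∫ s in (0 : ℝ)..t, S s.toNNReal x
      map_add' := fun x y => by
        simp only [map_add]
        exact intervalIntegral.integral_add
          ((hS.continuous_apply_toNNReal x).intervalIntegrable _ _)
          ((hS.continuous_apply_toNNReal y).intervalIntegrable _ _)
      map_smul' := fun c x => by
        simp only [map_smul]
        exact intervalIntegral.integral_smul c _ }
    t fun x => by
      have := intervalIntegral.norm_integral_le_of_norm_le_const (a := 0) (b := (t : ℝ))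
        (f := fun s => S s.toNNReal x) fun s _ => hS.norm_apply_le s.toNNReal x
      simpa [mul_comm] using this

theorem integral_apply (hS : IsContractionSemigroup S) (t : ℝ≥0) (x : X) :
    hS.integral t x = ∫ s in (0 : ℝ)..t, S s.toNNReal x := rfl

theorem norm_integral_apply_le (hS : IsContractionSemigroup S) (t : ℝ≥0) (x : X) :
    ‖hS.integral t x‖ ≤ t * ‖x‖ := by
  have := intervalIntegral.norm_integral_le_of_norm_le_const (a := 0) (b := (t : ℝ))
    (f := fun s => S s.toNNReal x) fun s _ => hS.norm_apply_le s.toNNReal x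
  rwa [sub_zero, abs_of_nonneg t.coe_nonneg, mul_comm] at this

/-! ### The integrated semigroup and the generator. -/

variable [CompleteSpace X]

theorem tendsto_average (hS : IsContractionSemigroup S) (x : X) :
    Tendsto (fun t : ℝ≥0 => (t : ℝ)⁻¹ • hS.integral t x) (𝓝[>] 0) (𝓝 x) := by
  simpa [integral_apply, hS.zero] using
    tendsto_average_integral (hS.continuous_apply_toNNReal x) 0

/-- `S_h - 1` applied to `∫₀ᵗ S_s x ds` leaves `∫ₜ^{t+h} - ∫₀ʰ`, whose averages over length `h` tend
to `S_t x` and `x`. -/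
theorem integral_mem_generatorGraph (hS : IsContractionSemigroup S) (t : ℝ≥0) (x : X) :
    (hS.integral t x, S t x - x) ∈ generatorGraph S := by
  have hc := hS.continuous_apply_toNNReal x
  have hi (a b : ℝ) : IntervalIntegrable (fun s : ℝ => S s.toNNReal x) volume a b :=
    hc.intervalIntegrable a b
  have h1 := (tendsto_average_integral hc t).sub (tendsto_average_integral hc 0)
  simp only [Real.toNNReal_coe, Real.toNNReal_zero, hS.zero, zero_add,
    ContinuousLinearMap.id_apply] at h1
  refine h1.congr fun h => ?_
  rw [← smul_sub]
  congr 1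
  have h2 : S h (hS.integral t x) = ∫ s in (h : ℝ)..(t + h), S s.toNNReal x := by
    rw [integral_apply, ← ContinuousLinearMap.intervalIntegral_comp_comm _ (hi _ _)]
    have h3 := intervalIntegral.integral_comp_add_right (a := 0) (b := (t : ℝ))
      (fun s : ℝ => S s.toNNReal x) (h : ℝ)
    rw [zero_add] at h3
    rw [← h3]
    refine intervalIntegral.integral_congr fun s hs => ?_
    rw [Set.uIcc_of_le t.coe_nonneg] at hs
    rw [Real.toNNReal_add hs.1 h.coe_nonneg, Real.toNNReal_coe, add_comm, hS.add_apply]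
  change _ = S h (hS.integral t x) - hS.integral t x
  rw [h2, integral_apply]
  have h4 := intervalIntegral.integral_add_adjacent_intervals (hi 0 t) (hi t (t + h))
  have h5 := intervalIntegral.integral_add_adjacent_intervals (hi 0 h) (hi h (t + h))
  rw [sub_eq_sub_iff_add_eq_add, add_comm (∫ s in (t : ℝ).._, _), h4,
    add_comm (∫ s in (h : ℝ).._, _), h5]

theorem apply_integral (hS : IsContractionSemigroup S) (h t : ℝ≥0) (x : X) :
    S h (hS.integral t x) = hS.integral t (S h x) := by
  rw [integral_apply, ← ContinuousLinearMap.intervalIntegral_comp_comm _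
    ((hS.continuous_apply_toNNReal x).intervalIntegrable _ _)]
  exact intervalIntegral.integral_congr fun s _ => hS.apply_comm _ _ _

theorem dense_domain_generator (hS : IsContractionSemigroup S) :
    Dense ((generator S).domain : Set X) := fun x =>
  mem_closure_of_tendsto (hS.tendsto_average x) <| Eventually.of_forall fun t =>
    Submodule.smul_mem _ _ ⟨_, hS.integral_mem_generatorGraph t x, rfl⟩

theorem integral_snd (hS : IsContractionSemigroup S) {w : X × X} (hw : w ∈ generatorGraph S)
    (t : ℝ≥0) : hS.integral t w.2 = S t w.1 - w.1 := by
  refine tendsto_nhds_unique (((hS.integral t).continuous.tendsto _).comp hw) ?_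
  refine (hS.integral_mem_generatorGraph t w.1).congr fun h => ?_
  simp only [Function.comp, map_smul, map_sub, hS.apply_integral]

/-! ### The adjoint of the generator. -/

omit [CompleteSpace X] in
theorem mem_dualAdjointGraph_iff {ξ η : StrongDual ℝ X} :
    (ξ, η) ∈ dualAdjointGraph (generator S) ↔ ∀ w ∈ generatorGraph S, ξ w.2 = η w.1 := by
  rw [← generator_graph]
  refine ⟨fun h w hw => ?_, fun h x => h _ ((generator S).mem_graph x)⟩
  obtain ⟨x, h1, h2⟩ := (LinearPMap.mem_graph_iff _).1 hw
  rw [← h1, ← h2]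
  exact h x

theorem mem_dualAdjointGraph_dualAdjoint (hS : IsContractionSemigroup S)
    (ξ : (dualAdjoint (generator S)).domain) :
    ((ξ : StrongDual ℝ X), dualAdjoint (generator S) ξ) ∈ dualAdjointGraph (generator S) := by
  rw [← dualAdjoint_graph _ hS.dense_domain_generator]
  exact LinearPMap.mem_graph _ ξ

/-- Integrated form of `d/dt (ξ ∘ S_t) = A*ξ ∘ S_t`. It avoids differentiating the adjoint
semigroup, which need not be strongly continuous on the dual. -/
theorem dual_apply_sub (hS : IsContractionSemigroup S) {ξ η : StrongDual ℝ X}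
    (h : (ξ, η) ∈ dualAdjointGraph (generator S)) (t : ℝ≥0) (x : X) :
    ξ (S t x) - ξ x = η (hS.integral t x) := by
  rw [← map_sub]
  exact mem_dualAdjointGraph_iff.1 h _ (hS.integral_mem_generatorGraph t x)

omit [CompleteSpace X] in
theorem comp_mem_dualAdjointGraph (hS : IsContractionSemigroup S) {ξ η : StrongDual ℝ X}
    (h : (ξ, η) ∈ dualAdjointGraph (generator S)) (t : ℝ≥0) :
    (ξ ∘L S t, η ∘L S t) ∈ dualAdjointGraph (generator S) :=
  mem_dualAdjointGraph_iff.2 fun _ hw =>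
    mem_dualAdjointGraph_iff.1 h _ (hS.map_mem_generatorGraph hw t)

theorem comp_integral_mem_dualAdjointGraph (hS : IsContractionSemigroup S) (a : StrongDual ℝ X)
    (t : ℝ≥0) : (a ∘L hS.integral t, a ∘L (S t - .id ℝ X)) ∈ dualAdjointGraph (generator S) :=
  mem_dualAdjointGraph_iff.2 fun _ hw => congr(a $(hS.integral_snd hw t))

/-- The domain of `A*` separates the points of `X`. -/
theorem eq_zero_of_forall_domain_dualAdjoint (hS : IsContractionSemigroup S) {x : X}
    (hx : ∀ ξ : (dualAdjoint (generator S)).domain, (ξ : StrongDual ℝ X) x = 0) : x = 0 := by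
  refine SeparatingDual.eq_zero_of_forall_dual_eq_zero (R := ℝ) fun a => ?_
  refine tendsto_nhds_unique ((a.continuous.tendsto _).comp (hS.tendsto_average x)) ?_
  refine tendsto_const_nhds.congr fun t => ?_
  have h1 := hx ⟨a ∘L hS.integral t, ⟨_, hS.comp_integral_mem_dualAdjointGraph a t, rfl⟩⟩
  have h2 : a (hS.integral t x) = 0 := h1
  simp [h2]

/-- On `D(A*)` the adjoint semigroup is Lipschitz in norm with constant `‖A*ξ‖`. This makes the
integrand of `Q_t ξ` continuous for such `ξ`. -/
theorem norm_comp_sub_comp_le (hS : IsContractionSemigroup S) {ξ η : StrongDual ℝ X}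
    (h : (ξ, η) ∈ dualAdjointGraph (generator S)) (s t : ℝ≥0) :
    ‖ξ ∘L S t - ξ ∘L S s‖ ≤ dist t s * ‖η‖ := by
  wlog hst : s ≤ t generalizing s t
  · rw [norm_sub_rev, dist_comm]
    exact this t s (le_of_not_ge hst)
  refine ContinuousLinearMap.opNorm_le_bound _ (by positivity) fun x => ?_
  have h1 : (ξ ∘L S t - ξ ∘L S s) x = η (hS.integral (t - s) (S s x)) := by
    rw [← hS.dual_apply_sub h, ← hS.add_apply, tsub_add_cancel_of_le hst]
    rfl
  have h2 : ((t - s : ℝ≥0) : ℝ) = dist t s := by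
    rw [NNReal.dist_eq, NNReal.coe_sub hst, abs_of_nonneg (sub_nonneg.2 (by exact_mod_cast hst))]
  rw [h1]
  calc ‖η (hS.integral (t - s) (S s x))‖ ≤ ‖η‖ * ‖hS.integral (t - s) (S s x)‖ := η.le_opNorm _
    _ ≤ ‖η‖ * (dist t s * ‖x‖) := by
        gcongr
        refine (hS.norm_integral_apply_le _ _).trans ?_
        rw [h2]
        gcongr
        exact hS.norm_apply_le _ _
    _ = _ := by ring

theorem continuous_comp (hS : IsContractionSemigroup S) {ξ η : StrongDual ℝ X}
    (h : (ξ, η) ∈ dualAdjointGraph (generator S)) : Continuous fun t => ξ ∘L S t := by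
  refine continuous_iff_continuousAt.2 fun s => tendsto_iff_norm_sub_tendsto_zero.2 ?_
  refine squeeze_zero (fun _ => norm_nonneg _) (fun t => hS.norm_comp_sub_comp_le h s t) ?_
  have : Continuous fun t => dist t s * ‖η‖ := by fun_prop
  exact this.tendsto' _ _ (by simp)

/-! ### The Lyapunov equation -/

theorem continuous_covariance_integrand (hS : IsContractionSemigroup S) (Q : NonnegSymmOp X)
    {ξ η : StrongDual ℝ X} (h : (ξ, η) ∈ dualAdjointGraph (generator S)) :
    Continuous fun s : ℝ => S s.toNNReal (Q.op (ξ ∘L S s.toNNReal)) := by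
  have h1 : Continuous fun s : ℝ≥0 => S s (Q.op (ξ ∘L S s)) :=
    continuous_iff_continuousAt.2 fun s => hS.tendsto_apply tendsto_id
      ((Q.op.continuous.comp (hS.continuous_comp h)).tendsto s)
  exact h1.comp continuous_real_toNNReal

/-- The integral is cut at `t`; a shift by `t` then factors `S_t` and its adjoint out of the second
piece. -/
theorem covarianceAt_add (hS : IsContractionSemigroup S) (Q : NonnegSymmOp X)
    {ξ η : StrongDual ℝ X} (h : (ξ, η) ∈ dualAdjointGraph (generator S)) (s t : ℝ≥0) :
    covarianceAt Q S (t + s) ξ = covarianceAt Q S t ξ + S t (covarianceAt Q S s (ξ ∘L S t)) := by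
  have hc := hS.continuous_covariance_integrand Q h
  have hc' := hS.continuous_covariance_integrand Q (hS.comp_mem_dualAdjointGraph h t)
  have h1 : S t (covarianceAt Q S s (ξ ∘L S t)) =
      ∫ r in (t : ℝ)..(t + s), S r.toNNReal (Q.op (ξ ∘L S r.toNNReal)) := by
    rw [covarianceAt, ← ContinuousLinearMap.intervalIntegral_comp_comm _
      (hc'.intervalIntegrable _ _)]
    have h3 := intervalIntegral.integral_comp_add_left (a := 0) (b := (s : ℝ))
      (fun r : ℝ => S r.toNNReal (Q.op (ξ ∘L S r.toNNReal))) (t : ℝ)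
    rw [add_zero] at h3
    rw [← h3]
    refine intervalIntegral.integral_congr fun r hr => ?_
    rw [Set.uIcc_of_le s.coe_nonneg] at hr
    rw [Real.toNNReal_add t.coe_nonneg hr.1, Real.toNNReal_coe, hS.add_apply, hS.add]
    rfl
  rw [h1]
  exact (intervalIntegral.integral_add_adjacent_intervals (hc.intervalIntegrable _ _)
    (hc.intervalIntegrable _ _)).symm

theorem limit_covariance_eq (hS : IsContractionSemigroup S) (Q : NonnegSymmOp X)
    {Qinf : StrongDual ℝ X →L[ℝ] X}
    (hlim : ∀ a b : StrongDual ℝ X,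
      Tendsto (fun t : ℝ => b (covarianceAt Q S t a)) atTop (𝓝 (b (Qinf a))))
    {ξ η : StrongDual ℝ X} (h : (ξ, η) ∈ dualAdjointGraph (generator S)) (t : ℝ≥0) :
    ξ (Qinf ξ) = ξ (covarianceAt Q S t ξ) + (ξ ∘L S t) (Qinf (ξ ∘L S t)) := by
  have h1 : Tendsto (fun s : ℝ≥0 => ((t + s : ℝ≥0) : ℝ)) atTop atTop :=
    NNReal.tendsto_coe_atTop.2 (tendsto_atTop_mono (fun _ => le_add_self) tendsto_id)
  refine tendsto_nhds_unique ((hlim ξ ξ).comp h1) ?_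
  refine (((hlim (ξ ∘L S t) (ξ ∘L S t)).comp
    (NNReal.tendsto_coe_atTop.2 tendsto_id)).const_add _).congr fun s => ?_
  simp only [Function.comp, NNReal.coe_add, hS.covarianceAt_add Q h, map_add]
  rfl

/-- The Lyapunov equation `Q_∞ A* + A Q_∞ = -Q` in weak form. -/
theorem lyapunov (hS : IsContractionSemigroup S) (Q : NonnegSymmOp X)
    {Qinf : StrongDual ℝ X →L[ℝ] X}
    (hlim : ∀ a b : StrongDual ℝ X,
      Tendsto (fun t : ℝ => b (covarianceAt Q S t a)) atTop (𝓝 (b (Qinf a))))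
    (hsymm : ∀ a b : StrongDual ℝ X, b (Qinf a) = a (Qinf b))
    {ξ η : StrongDual ℝ X} (h : (ξ, η) ∈ dualAdjointGraph (generator S)) :
    ξ (Qinf η) = -(ξ (Q.op ξ) / 2) := by
  have hid : Tendsto (fun t : ℝ≥0 => t) (𝓝[>] 0) (𝓝 0) := nhdsWithin_le_nhds
  have h1 : Tendsto (fun t : ℝ≥0 => ξ ((t : ℝ)⁻¹ • covarianceAt Q S t ξ)) (𝓝[>] 0)
      (𝓝 (ξ (Q.op ξ))) := by
    have := tendsto_average_integral (hS.continuous_covariance_integrand Q h) 0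
    simp only [zero_add, Real.toNNReal_zero, hS.zero, ContinuousLinearMap.comp_id,
      ContinuousLinearMap.id_apply] at this
    exact (ξ.continuous.tendsto _).comp this
  have hz : Tendsto (fun t : ℝ≥0 => Qinf (ξ ∘L S t + ξ)) (𝓝[>] 0) (𝓝 (Qinf (ξ + ξ))) := by
    have h2 : Tendsto (fun t : ℝ≥0 => ξ ∘L S t) (𝓝[>] 0) (𝓝 ξ) := by
      have := ((hS.continuous_comp h).tendsto 0).comp hid
      rwa [hS.zero] at this
    exact (Qinf.continuous.tendsto _).comp (h2.add_const ξ)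
  have h2 : Tendsto (fun t : ℝ≥0 => η ((t : ℝ)⁻¹ • hS.integral t (Qinf (ξ ∘L S t + ξ))))
      (𝓝[>] 0) (𝓝 (η (Qinf (ξ + ξ)))) := by
    refine (η.continuous.tendsto _).comp ?_
    rw [tendsto_iff_norm_sub_tendsto_zero]
    have h3 := (tendsto_iff_norm_sub_tendsto_zero.1 hz).add
      (tendsto_iff_norm_sub_tendsto_zero.1 (hS.tendsto_average (Qinf (ξ + ξ))))
    rw [add_zero] at h3
    refine squeeze_zero' (Eventually.of_forall fun _ => norm_nonneg _) ?_ h3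
    filter_upwards [self_mem_nhdsWithin] with t ht
    have ht0 : (0 : ℝ) < t := ht
    refine (norm_sub_le_norm_sub_add_norm_sub _
      ((t : ℝ)⁻¹ • hS.integral t (Qinf (ξ + ξ))) _).trans ?_
    rw [← smul_sub, ← map_sub, norm_smul, norm_inv, Real.norm_of_nonneg ht0.le]
    refine add_le_add_left ?_ _
    rw [inv_mul_le_iff₀ ht0]
    exact hS.norm_integral_apply_le t _
  -- With `q(a) = a (Q_∞ a)` and `Q_∞` symmetric, `q(ξ ∘ S_t) - q(ξ) = (ξ ∘ S_t - ξ)(Q_∞ (ξ ∘ S_t +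
  -- ξ))`. By `dual_apply_sub` the difference quotient of `q` becomes an average of the semigroup
  -- paired with `η`, so `limit_covariance_eq` divided by `t` has a limit.
  have h3 : Tendsto (fun _ : ℝ≥0 => (0 : ℝ)) (𝓝[>] 0)
      (𝓝 (ξ (Q.op ξ) + η (Qinf (ξ + ξ)))) := by
    refine (h1.add h2).congr fun t => ?_
    rw [map_smul, map_smul, ← smul_add, smul_eq_zero]
    right
    rw [← hS.dual_apply_sub h]
    have h4 := hS.limit_covariance_eq Q hlim h t
    have h5 := hsymm ξ (ξ ∘L S t)
    simp only [map_add, ContinuousLinearMap.comp_apply] at h4 h5 ⊢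
    linarith
  have h4 := tendsto_nhds_unique h3 tendsto_const_nhds
  rw [hsymm, ← sub_eq_zero]
  simp only [map_add] at h4
  linarith

/-! ### The drift operator -/

/-- The restriction of `i*` to the domain of `A*`. -/
def inclusionAdjDomain (Q : NonnegSymmOp X) (A : X →ₗ.[ℝ] X) :
    (dualAdjoint A).domain →ₗ[ℝ] KernelSpace Q where
  toFun ξ := inclusionAdj Q ξ
  map_add' a b := map_add (inclusionAdj Q) (a : StrongDual ℝ X) b
  map_smul' c a := map_smul (inclusionAdj Q) c (a : StrongDual ℝ X)

/-- If `h` is orthogonal to every `i* ξ`, then `ξ (i h) = 0` for all `ξ ∈ D(A*)`. As `D(A*)`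
separates points, `i h = 0`, and `i` is injective. -/
theorem denseRange_inclusionAdjDomain (hS : IsContractionSemigroup S) (Q : NonnegSymmOp X) :
    DenseRange (inclusionAdjDomain Q (generator S)) := by
  rw [denseRange_iff_closure_range, ← LinearMap.coe_range, ← Submodule.topologicalClosure_coe,
    ← Submodule.top_coe (R := ℝ), SetLike.coe_set_eq, Submodule.topologicalClosure_eq_top_iff,
    Submodule.eq_bot_iff]
  intro h hh
  refine (injective_iff_map_eq_zero _).1 (inclusion_injective Q) h ?_
  refine hS.eq_zero_of_forall_domain_dualAdjoint fun ξ => ?_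
  rw [← inner_inclusionAdj]
  exact hh _ ⟨ξ, rfl⟩

theorem exists_isDriftOperator (hS : IsContractionSemigroup S) (Q : NonnegSymmOp X)
    {Qinf : StrongDual ℝ X →L[ℝ] X} (hB : DriftBound Q (generator S) Qinf) :
    ∃ B, IsDriftOperator Q (generator S) Qinf B :=
  exists_extension_inclusionAdj Q _ (hS.denseRange_inclusionAdjDomain Q)
    (Qinf.toLinearMap ∘ₗ (dualAdjoint (generator S)).toFun) hB

theorem isDriftOperator_driftOperator (hS : IsContractionSemigroup S) (Q : NonnegSymmOp X)
    {Qinf : StrongDual ℝ X →L[ℝ] X} (hB : DriftBound Q (generator S) Qinf) :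
    IsDriftOperator Q (generator S) Qinf (driftOperator Q (generator S) Qinf) := by
  rw [driftOperator, dif_pos (hS.exists_isDriftOperator Q hB)]
  exact (hS.exists_isDriftOperator Q hB).choose_spec

/-- `B + B* = -I`. -/
theorem inner_driftOperator_self (hS : IsContractionSemigroup S) (Q : NonnegSymmOp X)
    {Qinf : StrongDual ℝ X →L[ℝ] X}
    (hlim : ∀ a b : StrongDual ℝ X,
      Tendsto (fun t : ℝ => b (covarianceAt Q S t a)) atTop (𝓝 (b (Qinf a))))
    (hsymm : ∀ a b : StrongDual ℝ X, b (Qinf a) = a (Qinf b))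
    {B : KernelSpace Q →L[ℝ] KernelSpace Q} (hB : IsDriftOperator Q (generator S) Qinf B)
    (h : KernelSpace Q) : ⟪B h, h⟫_ℝ = -(‖h‖ ^ 2 / 2) := by
  refine (hS.denseRange_inclusionAdjDomain Q).induction_on
    (p := fun h => ⟪B h, h⟫_ℝ = -(‖h‖ ^ 2 / 2)) h (isClosed_eq (by fun_prop) (by fun_prop)) ?_
  intro ξ
  change ⟪B (inclusionAdj Q ξ), inclusionAdj Q ξ⟫_ℝ = -(‖inclusionAdj Q ξ‖ ^ 2 / 2)
  rw [real_inner_comm, inner_inclusionAdj, hB ξ, ← real_inner_self_eq_norm_sq,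
    inner_inclusionAdj, inclusion_inclusionAdj]
  exact hS.lyapunov Q hlim hsymm (hS.mem_dualAdjointGraph_dualAdjoint ξ)

/-- The vectors `B i* ξ`, `ξ ∈ D(A*)`, separate the points of `H`. -/
theorem eq_zero_of_forall_inner_driftOperator (hS : IsContractionSemigroup S)
    (Q : NonnegSymmOp X) {B : KernelSpace Q →L[ℝ] KernelSpace Q}
    (hB : ∀ h, ⟪B h, h⟫_ℝ = -(‖h‖ ^ 2 / 2)) {k : KernelSpace Q}
    (hk : ∀ ξ : (dualAdjoint (generator S)).domain, ⟪B (inclusionAdj Q ξ), k⟫_ℝ = 0) : k = 0 := by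
  have h1 : ∀ h, ⟪B h, k⟫_ℝ = 0 := fun h =>
    (hS.denseRange_inclusionAdjDomain Q).induction_on
      (p := fun h => ⟪B h, k⟫_ℝ = 0) h (isClosed_eq (by fun_prop) (by fun_prop)) hk
  -- By density `k` is orthogonal to the whole range of `B`, in particular to `B k`.
  have h2 := hB k
  rw [h1 k] at h2
  rw [← norm_eq_zero]
  nlinarith [norm_nonneg k]

end IsContractionSemigroup

end Banach

/-! ### Bounded `C¹` functions with bounded derivative -/

/-- `f` is a bounded `C¹` function with bounded derivative. -/
structure IsC1Bounded {E : Type*} [NormedAddCommGroup E] [NormedSpace ℝ E] (f : E → ℝ) : Prop where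
  contDiff : ContDiff ℝ 1 f
  bounded : ∃ C, ∀ y, ‖f y‖ ≤ C
  bounded_fderiv : ∃ C, ∀ y, ‖fderiv ℝ f y‖ ≤ C

namespace IsC1Bounded

variable {E F : Type*} [NormedAddCommGroup E] [NormedSpace ℝ E] [NormedAddCommGroup F]
  [NormedSpace ℝ F] {f g : E → ℝ}

theorem differentiable (hf : IsC1Bounded f) : Differentiable ℝ f :=
  hf.contDiff.differentiable one_ne_zero

theorem continuous (hf : IsC1Bounded f) : Continuous f := hf.contDiff.continuous

theorem continuous_fderiv (hf : IsC1Bounded f) : Continuous (fderiv ℝ f) :=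
  hf.contDiff.continuous_fderiv one_ne_zero

theorem fderiv_mul (hf : IsC1Bounded f) (hg : IsC1Bounded g) (x : E) :
    fderiv ℝ (fun x => f x * g x) x = f x • fderiv ℝ g x + g x • fderiv ℝ f x :=
  fderiv_fun_mul (hf.differentiable x) (hg.differentiable x)

theorem mul (hf : IsC1Bounded f) (hg : IsC1Bounded g) : IsC1Bounded fun x => f x * g x where
  contDiff := hf.contDiff.mul hg.contDiff
  bounded := by
    obtain ⟨C, hC⟩ := hf.bounded
    obtain ⟨D, hD⟩ := hg.bounded
    refine ⟨C * D, fun y => ?_⟩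
    rw [norm_mul]
    gcongr
    · exact (norm_nonneg _).trans (hC y)
    · exact hC y
    · exact hD y
  bounded_fderiv := by
    obtain ⟨C, hC⟩ := hf.bounded
    obtain ⟨D, hD⟩ := hg.bounded
    obtain ⟨C', hC'⟩ := hf.bounded_fderiv
    obtain ⟨D', hD'⟩ := hg.bounded_fderiv
    refine ⟨C * D' + D * C', fun y => ?_⟩
    rw [hf.fderiv_mul hg]
    refine (norm_add_le _ _).trans ?_
    rw [norm_smul, norm_smul]
    gcongr
    · exact (norm_nonneg _).trans (hC y)
    · exact hC y
    · exact hD' y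
    · exact (norm_nonneg _).trans (hD y)
    · exact hD y
    · exact hC' y

theorem fderiv_comp {θ : ℝ → ℝ} (hθ : IsC1Bounded θ) (hf : IsC1Bounded f) (x : E) :
    fderiv ℝ (fun x => θ (f x)) x = deriv θ (f x) • fderiv ℝ f x :=
  ((hθ.differentiable (f x)).hasDerivAt.comp_hasFDerivAt x
    (hf.differentiable x).hasFDerivAt).fderiv

theorem comp {θ : ℝ → ℝ} (hθ : IsC1Bounded θ) (hf : IsC1Bounded f) :
    IsC1Bounded fun x => θ (f x) where
  contDiff := hθ.contDiff.comp hf.contDiff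
  bounded := by
    obtain ⟨C, hC⟩ := hθ.bounded
    exact ⟨C, fun y => hC _⟩
  bounded_fderiv := by
    obtain ⟨C, hC⟩ := hθ.bounded_fderiv
    obtain ⟨D, hD⟩ := hf.bounded_fderiv
    refine ⟨C * D, fun y => ?_⟩
    rw [hθ.fderiv_comp hf, norm_smul, norm_deriv_eq_norm_fderiv]
    gcongr
    · exact (norm_nonneg _).trans (hC 0)
    · exact hC _
    · exact hD _

theorem comp_clm (hf : IsC1Bounded f) (L : F →L[ℝ] E) : IsC1Bounded fun x => f (L x) where
  contDiff := hf.contDiff.comp L.contDiff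
  bounded := by
    obtain ⟨C, hC⟩ := hf.bounded
    exact ⟨C, fun y => hC _⟩
  bounded_fderiv := by
    obtain ⟨C, hC⟩ := hf.bounded_fderiv
    refine ⟨C * ‖L‖, fun y => ?_⟩
    have hd : HasFDerivAt (fun y => f (L y)) ((fderiv ℝ f (L y)) ∘L L) y :=
      (hf.differentiable (L y)).hasFDerivAt.comp y L.hasFDerivAt
    rw [hd.fderiv]
    refine (ContinuousLinearMap.opNorm_comp_le _ _).trans ?_
    gcongr
    exact hC _

theorem of_deriv {θ : ℝ → ℝ} (hθ : ContDiff ℝ 1 θ) {C D : ℝ} (hC : ∀ t, |θ t| ≤ C)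
    (hD : ∀ t, |deriv θ t| ≤ D) : IsC1Bounded θ :=
  ⟨hθ, ⟨C, hC⟩, ⟨D, fun t => by rw [← norm_deriv_eq_norm_fderiv]; exact hD t⟩⟩

theorem cos : IsC1Bounded Real.cos :=
  of_deriv Real.contDiff_cos Real.abs_cos_le_one (D := 1) fun t => by
    simpa using Real.abs_sin_le_one t

theorem sin : IsC1Bounded Real.sin :=
  of_deriv Real.contDiff_sin Real.abs_sin_le_one (D := 1) fun t => by
    simpa using Real.abs_cos_le_one t

end IsC1Bounded

/-- Integration by parts holds in this larger class, where products and compositions need no common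
system of coordinates. -/
theorem IsCylindrical.isC1Bounded {X : Type*} [NormedAddCommGroup X] [NormedSpace ℝ X]
    {f : X → ℝ} (hf : IsCylindrical f) : IsC1Bounded f := by
  obtain ⟨n, φ, ξ, hφ, hf⟩ := hf
  rw [funext hf]
  exact (IsC1Bounded.mk hφ.contDiff hφ.bounded hφ.bounded_fderiv).comp_clm
    (ContinuousLinearMap.pi ξ)

theorem IsC1Bounded.isCylindrical {X : Type*} [NormedAddCommGroup X] [NormedSpace ℝ X]
    {θ : ℝ → ℝ} (hθ : IsC1Bounded θ) (L : StrongDual ℝ X) : IsCylindrical fun x => θ (L x) := by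
  have h := hθ.comp_clm (ContinuousLinearMap.proj (R := ℝ) (φ := fun _ : Fin 1 => ℝ) 0)
  exact ⟨1, _, fun _ => L, ⟨h.contDiff, h.bounded, h.bounded_fderiv⟩, fun x => rfl⟩

/-! ### Integration by parts for centred Gaussian measures -/

section Gaussian

variable {X : Type*} [NormedAddCommGroup X] [NormedSpace ℝ X] [CompleteSpace X]
  [SecondCountableTopology X] [MeasurableSpace X] [BorelSpace X]

/-- For independent copies `x, y`, the law of `(cos θ x + sin θ y, -sin θ x + cos θ y)` does not
depend on `θ`. Hence `E[a(-sin θ x + cos θ y) f(cos θ x + sin θ y)] = E[a(y)] E[f(x)] = 0` for all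
`θ`. The derivative at `θ = 0` is `E[a(y) Df(x) y - a(x) f(x)]`, and integrating in `y` turns the
first term into `Df(x)(R a)`. -/
theorem IsCenteredGaussian.integral_fderiv {μ : Measure X} {R : StrongDual ℝ X → X}
    (hμ : IsCenteredGaussian μ R) {f : X → ℝ} (hf : IsC1Bounded f) (a : StrongDual ℝ X) :
    ∫ x, fderiv ℝ f x (R a) ∂μ = ∫ x, f x * a x ∂μ := by
  have := hμ.gaussian
  obtain ⟨M, hM⟩ := hf.bounded
  obtain ⟨C, hC⟩ := hf.bounded_fderiv
  have hM0 : 0 ≤ M := (norm_nonneg _).trans (hM 0)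
  have hC0 : 0 ≤ C := (norm_nonneg _).trans (hC 0)
  let F : ℝ → X × X → ℝ := fun θ p =>
    a (-Real.sin θ • p.1 + Real.cos θ • p.2) * f (Real.cos θ • p.1 + Real.sin θ • p.2)
  let F' : ℝ → X × X → ℝ := fun θ p =>
    a (-Real.cos θ • p.1 - Real.sin θ • p.2) * f (Real.cos θ • p.1 + Real.sin θ • p.2) +
    a (-Real.sin θ • p.1 + Real.cos θ • p.2) *
      fderiv ℝ f (Real.cos θ • p.1 + Real.sin θ • p.2) (-Real.sin θ • p.1 + Real.cos θ • p.2)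
  have hfc := hf.continuous
  have hfc' := hf.continuous_fderiv
  have hFc (θ : ℝ) : Continuous (F θ) := by fun_prop
  have hF'c (θ : ℝ) : Continuous (F' θ) := by
    have h1 : Continuous fun p : X × X =>
      fderiv ℝ f (Real.cos θ • p.1 + Real.sin θ • p.2) (-Real.sin θ • p.1 + Real.cos θ • p.2) :=
      (hfc'.comp (by fun_prop)).clm_apply (by fun_prop)
    fun_prop
  have hF0 (θ : ℝ) : ∫ p, F θ p ∂(μ.prod μ) = 0 := by
    have h1 := ProbabilityTheory.IsGaussian.map_rotation_eq_self_of_forall_strongDual_eq_zero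
      hμ.centered θ
    have h2 : ∫ p : X × X, f p.1 * a p.2 ∂(μ.prod μ) = 0 := by
      rw [integral_prod_mul f a, hμ.centered, mul_zero]
    rw [← h1, integral_map (by fun_prop) (by fun_prop)] at h2
    rw [← h2]
    refine integral_congr_ae (Eventually.of_forall fun p => ?_)
    simp only [F, ContinuousLinearMap.rotation_apply]
    ring
  have hn1 : Integrable (fun x : X => ‖x‖) μ := ProbabilityTheory.IsGaussian.integrable_id.norm
  have hn2 : Integrable (fun x : X => ‖x‖ ^ 2) μ :=
    ((memLp_two_iff_integrable_sq_norm (by fun_prop)).1 ProbabilityTheory.IsGaussian.memLp_two_id)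
  -- Majorant of the `θ`-derivative, uniform in `θ`: rotated vectors have norm at most `‖x‖ + ‖y‖`,
  -- and Gaussian norms have second moments.
  let bound : X × X → ℝ := fun p =>
    ‖a‖ * M * (‖p.1‖ + ‖p.2‖) + ‖a‖ * C * (2 * (‖p.1‖ ^ 2 + ‖p.2‖ ^ 2))
  have hbound : Integrable bound (μ.prod μ) :=
    (((hn1.comp_fst μ).add (hn1.comp_snd μ)).const_mul _).add
      ((((hn2.comp_fst μ).add (hn2.comp_snd μ)).const_mul 2).const_mul _)
  have hrot (c s : ℝ) (hc : |c| ≤ 1) (hs : |s| ≤ 1) (p : X × X) :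
      ‖c • p.1 + s • p.2‖ ≤ ‖p.1‖ + ‖p.2‖ := by
    refine (norm_add_le _ _).trans ?_
    rw [norm_smul, norm_smul]
    exact add_le_add (mul_le_of_le_one_left (norm_nonneg _) hc)
      (mul_le_of_le_one_left (norm_nonneg _) hs)
  have key := hasDerivAt_integral_of_dominated_loc_of_deriv_le (μ := μ.prod μ) (F := F) (F' := F')
    (x₀ := 0) (s := Set.univ) (bound := bound) univ_mem
    (Eventually.of_forall fun θ => (hFc θ).aestronglyMeasurable) ?_
    (hF'c 0).aestronglyMeasurable ?_ hbound ?_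
  · obtain ⟨hint, hder⟩ := key
    simp only [hF0] at hder
    have h0 := hder.unique (hasDerivAt_const 0 0)
    rw [integral_prod _ hint] at h0
    have hinner (x : X) : ∫ y, F' 0 (x, y) ∂μ = fderiv ℝ f x (R a) - f x * a x := by
      have h1 : Integrable (fun y => a y * fderiv ℝ f x y) μ :=
        (ProbabilityTheory.IsGaussian.memLp_dual μ a 2 (by simp)).integrable_mul
          (ProbabilityTheory.IsGaussian.memLp_dual μ (fderiv ℝ f x) 2 (by simp))
      have h2 (y : X) : F' 0 (x, y) = -(f x * a x) + a y * fderiv ℝ f x y := by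
        simp [F', mul_comm]
      simp only [h2]
      rw [integral_add (integrable_const _) h1, ← hμ.covariance]
      simp
      ring
    simp only [hinner] at h0
    rw [integral_sub, sub_eq_zero] at h0
    · exact h0
    · refine Integrable.of_bound (by fun_prop) (C * ‖R a‖) (Eventually.of_forall fun x => ?_)
      exact (fderiv ℝ f x).le_of_opNorm_le (hC x) _
    · exact (ProbabilityTheory.IsGaussian.integrable_dual μ a).bdd_mul hfc.aestronglyMeasurable
        (Eventually.of_forall hM)
  · have h1 : F 0 = fun p => f p.1 * a p.2 := by
      ext p
      simp [F, mul_comm]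
    rw [h1]
    exact Integrable.mul_prod (Integrable.of_bound hfc.aestronglyMeasurable M
      (Eventually.of_forall hM)) (ProbabilityTheory.IsGaussian.integrable_dual μ a)
  · refine Eventually.of_forall fun p θ _ => ?_
    have h1 : ‖-Real.cos θ • p.1 - Real.sin θ • p.2‖ ≤ ‖p.1‖ + ‖p.2‖ := by
      rw [sub_eq_add_neg, ← neg_smul]
      exact hrot _ _ (by simpa using Real.abs_cos_le_one θ) (by simpa using Real.abs_sin_le_one θ) p
    have h2 : ‖-Real.sin θ • p.1 + Real.cos θ • p.2‖ ≤ ‖p.1‖ + ‖p.2‖ :=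
      hrot _ _ (by simpa using Real.abs_sin_le_one θ) (Real.abs_cos_le_one θ) p
    have h3 : (‖p.1‖ + ‖p.2‖) * (‖p.1‖ + ‖p.2‖) ≤ 2 * (‖p.1‖ ^ 2 + ‖p.2‖ ^ 2) := by
      nlinarith [sq_nonneg (‖p.1‖ - ‖p.2‖)]
    calc ‖F' θ p‖ ≤ ‖a‖ * (‖p.1‖ + ‖p.2‖) * M +
          ‖a‖ * (‖p.1‖ + ‖p.2‖) * (C * (‖p.1‖ + ‖p.2‖)) := by
          refine (norm_add_le _ _).trans ?_
          rw [norm_mul, norm_mul]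
          gcongr
          · exact (a.le_opNorm _).trans (by gcongr)
          · exact hM _
          · exact (a.le_opNorm _).trans (by gcongr)
          · exact (ContinuousLinearMap.le_opNorm _ _).trans (by gcongr; exact hC _)
      _ = ‖a‖ * M * (‖p.1‖ + ‖p.2‖) +
          ‖a‖ * C * ((‖p.1‖ + ‖p.2‖) * (‖p.1‖ + ‖p.2‖)) := by ring
      _ ≤ bound p := by
          simp only [bound]
          gcongr
  · refine Eventually.of_forall fun p θ _ => ?_
    have h1 : HasDerivAt (fun θ : ℝ => Real.cos θ • p.1 + Real.sin θ • p.2)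
        (-Real.sin θ • p.1 + Real.cos θ • p.2) θ :=
      ((Real.hasDerivAt_cos θ).smul_const p.1).add ((Real.hasDerivAt_sin θ).smul_const p.2)
    have h2 : HasDerivAt (fun θ : ℝ => -Real.sin θ • p.1 + Real.cos θ • p.2)
        (-Real.cos θ • p.1 - Real.sin θ • p.2) θ := by
      have := ((Real.hasDerivAt_sin θ).neg.smul_const p.1).add
        ((Real.hasDerivAt_cos θ).smul_const p.2)
      rwa [neg_smul (Real.sin θ) p.2, ← sub_eq_add_neg] at this
    exact (a.hasFDerivAt.comp_hasDerivAt θ h2).mul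
      ((hf.differentiable _).hasFDerivAt.comp_hasDerivAt θ h1)

omit [CompleteSpace X] [SecondCountableTopology X] in
theorem integrable_exp_dual (μ : Measure X) [ProbabilityTheory.IsGaussian μ]
    (a : StrongDual ℝ X) : Integrable (fun x => Real.exp (a x)) μ := by
  have h := ProbabilityTheory.integrable_exp_mul_gaussianReal (μ := ∫ x, a x ∂μ)
    (v := (ProbabilityTheory.variance a μ).toNNReal) 1
  rw [← ProbabilityTheory.IsGaussian.map_eq_gaussianReal a,
    integrable_map_measure (by fun_prop) (by fun_prop)] at h
  simpa [Function.comp_def] using h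

/-! ### Density of the cylindrical functions -/

/-- The functions `cos ∘ L` and `sin ∘ L` are cylindrical, so the finite measures `φ⁺ ν` and `φ⁻ ν`
have the same characteristic functional and therefore coincide. -/
theorem ae_eq_zero_of_forall_isCylindrical {ν : Measure X} [IsFiniteMeasure ν] {φ : X → ℝ}
    (hφ : Integrable φ ν) (h : ∀ f : X → ℝ, IsCylindrical f → ∫ x, f x * φ x ∂ν = 0) :
    φ =ᵐ[ν] 0 := by
  have hm : AEMeasurable φ ν := hφ.aemeasurable
  have hp : AEMeasurable (fun x => ENNReal.ofReal (φ x)) ν := hm.ennreal_ofReal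
  have hn : AEMeasurable (fun x => ENNReal.ofReal (-φ x)) ν := hm.neg.ennreal_ofReal
  have hpf : ∫⁻ x, ENNReal.ofReal (φ x) ∂ν ≠ ∞ := hφ.lintegral_lt_top.ne
  have hnf : ∫⁻ x, ENNReal.ofReal (-φ x) ∂ν ≠ ∞ := hφ.neg.lintegral_lt_top.ne
  have : IsFiniteMeasure (ν.withDensity fun x => ENNReal.ofReal (φ x)) :=
    isFiniteMeasure_withDensity hpf
  have : IsFiniteMeasure (ν.withDensity fun x => ENNReal.ofReal (-φ x)) :=
    isFiniteMeasure_withDensity hnf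
  have hint (ψ : X → ℝ) (hψ : Integrable ψ ν) (L : StrongDual ℝ X) :
      Integrable (fun x => ψ x • Complex.exp (L x * Complex.I)) ν := by
    refine hψ.smul_bdd (C := 1) (by fun_prop) (Eventually.of_forall fun x => ?_)
    rw [Complex.norm_exp_ofReal_mul_I]
  have heq : (ν.withDensity fun x => ENNReal.ofReal (φ x)) =
      ν.withDensity fun x => ENNReal.ofReal (-φ x) := by
    refine Measure.ext_of_charFunDual (funext fun L => ?_)
    rw [charFunDual_apply, charFunDual_apply,
      integral_withDensity_eq_integral_toReal_smul₀ hp (by simp),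
      integral_withDensity_eq_integral_toReal_smul₀ hn (by simp), ← sub_eq_zero, ← integral_sub]
    · have h1 : ∀ x, (ENNReal.ofReal (φ x)).toReal • Complex.exp (L x * Complex.I) -
          (ENNReal.ofReal (-φ x)).toReal • Complex.exp (L x * Complex.I) =
          φ x • Complex.exp (L x * Complex.I) := by
        intro x
        rw [← sub_smul, ENNReal.toReal_ofReal', ENNReal.toReal_ofReal',
          max_zero_sub_max_neg_zero_eq_self]
      simp only [h1]
      apply Complex.ext
      · rw [← RCLike.re_eq_complex_re, ← integral_re (hint φ hφ L)]
        simpa [Complex.exp_ofReal_mul_I_re, mul_comm (φ _)] using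
          h _ (IsC1Bounded.cos.isCylindrical L)
      · rw [← RCLike.im_eq_complex_im, ← integral_im (hint φ hφ L)]
        simpa [Complex.exp_ofReal_mul_I_im, mul_comm (φ _)] using
          h _ (IsC1Bounded.sin.isCylindrical L)
    · refine hint _ ?_ L
      exact integrable_toReal_of_lintegral_ne_top hp hpf
    · refine hint _ ?_ L
      exact integrable_toReal_of_lintegral_ne_top hn hnf
  have h2 := (withDensity_eq_iff hp hn hpf).1 heq
  filter_upwards [h2] with x hx
  rcases le_total (φ x) 0 with h3 | h3
  · rw [ENNReal.ofReal_of_nonpos h3, eq_comm, ENNReal.ofReal_eq_zero] at hx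
    exact le_antisymm h3 (neg_nonpos.1 hx)
  · rw [ENNReal.ofReal_of_nonpos (neg_nonpos.2 h3), ENNReal.ofReal_eq_zero] at hx
    exact le_antisymm hx h3

end Gaussian

/-! ### Limits of integrals -/

section Limits

variable {α : Type*} [MeasurableSpace α] {μ : Measure α} {p : ℝ≥0∞} [Fact (1 ≤ p)]

theorem integral_norm_le_norm_Lp [IsProbabilityMeasure μ] (g : Lp ℝ p μ) :
    ∫ x, ‖g x‖ ∂μ ≤ ‖g‖ := by
  rw [integral_norm_eq_lintegral_enorm (Lp.aestronglyMeasurable g), ← eLpNorm_one_eq_lintegral_enorm,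
    Lp.norm_def]
  exact ENNReal.toReal_mono (Lp.eLpNorm_ne_top g)
    (eLpNorm_le_eLpNorm_of_exponent_le Fact.out (Lp.aestronglyMeasurable g))

/-- The factor `ψ(u_n)` is bounded but converges only in measure. With `d₀` frozen, dominated
convergence applies along almost everywhere convergent subsequences; the error from `d_n - d₀` is at
most `M C ‖d_n - d₀‖`. -/
theorem tendsto_integral_comp_mul [IsProbabilityMeasure μ] {u d : ℕ → Lp ℝ p μ} {u₀ d₀ : Lp ℝ p μ}
    (hu : Tendsto u atTop (𝓝 u₀)) (hd : Tendsto d atTop (𝓝 d₀)) {k : α → ℝ}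
    (hk : AEStronglyMeasurable k μ) {M : ℝ} (hM : ∀ x, ‖k x‖ ≤ M) {ψ : ℝ → ℝ} (hψ : Continuous ψ)
    {C : ℝ} (hC : ∀ t, ‖ψ t‖ ≤ C) :
    Tendsto (fun n => ∫ x, k x * ψ (u n x) * d n x ∂μ) atTop
      (𝓝 (∫ x, k x * ψ (u₀ x) * d₀ x ∂μ)) := by
  have hbd (v : Lp ℝ p μ) (x : α) : ‖k x * ψ (v x)‖ ≤ M * C := by
    rw [norm_mul]
    exact mul_le_mul (hM x) (hC _) (norm_nonneg _) ((norm_nonneg _).trans (hM x))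
  have hmeas (v : Lp ℝ p μ) : AEStronglyMeasurable (fun x => k x * ψ (v x)) μ :=
    hk.mul (hψ.comp_aestronglyMeasurable (Lp.aestronglyMeasurable v))
  have hLp (v : Lp ℝ p μ) : Integrable v μ := (Lp.memLp v).integrable Fact.out
  have h1 : Tendsto (fun n => ∫ x, k x * ψ (u n x) * d₀ x ∂μ) atTop
      (𝓝 (∫ x, k x * ψ (u₀ x) * d₀ x ∂μ)) := by
    refine tendsto_of_subseq_tendsto fun ns hns => ?_
    obtain ⟨ms, -, hms⟩ := (tendstoInMeasure_of_tendsto_Lp (hu.comp hns)).exists_seq_tendsto_ae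
    refine ⟨ms, tendsto_integral_of_dominated_convergence (fun x => M * C * ‖d₀ x‖)
      (fun n => (hmeas _).mul (Lp.aestronglyMeasurable d₀)) ((hLp d₀).norm.const_mul _)
      (fun n => Eventually.of_forall fun x => ?_) ?_⟩
    · rw [norm_mul]
      gcongr
      exact hbd _ _
    · filter_upwards [hms] with x hx
      exact (((hψ.tendsto _).comp hx).const_mul _).mul_const _
  have h2 : Tendsto (fun n => ∫ x, k x * ψ (u n x) * (d n x - d₀ x) ∂μ) atTop (𝓝 0) := by
    have h3 : Tendsto (fun n => M * C * ‖d n - d₀‖) atTop (𝓝 0) := by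
      simpa using (tendsto_iff_norm_sub_tendsto_zero.1 hd).const_mul (M * C)
    refine squeeze_zero_norm (fun n => ?_) h3
    have h4 : ∫ x, k x * ψ (u n x) * (d n x - d₀ x) ∂μ =
        ∫ x, k x * ψ (u n x) * (d n - d₀ : Lp ℝ p μ) x ∂μ := by
      refine integral_congr_ae ?_
      filter_upwards [Lp.coeFn_sub (d n) d₀] with x hx
      rw [hx, Pi.sub_apply]
    rw [h4]
    calc ‖∫ x, k x * ψ (u n x) * (d n - d₀ : Lp ℝ p μ) x ∂μ‖
        ≤ ∫ x, M * C * ‖(d n - d₀ : Lp ℝ p μ) x‖ ∂μ := by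
          refine norm_integral_le_of_norm_le ((hLp _).norm.const_mul _)
            (Eventually.of_forall fun x => ?_)
          rw [norm_mul]
          gcongr
          exact hbd _ _
      _ = M * C * ∫ x, ‖(d n - d₀ : Lp ℝ p μ) x‖ ∂μ := integral_const_mul _ _
      _ ≤ M * C * ‖d n - d₀‖ := by
          obtain ⟨x⟩ := nonempty_of_isProbabilityMeasure μ
          exact mul_le_mul_of_nonneg_left (integral_norm_le_norm_Lp _)
            ((norm_nonneg _).trans (hbd u₀ x))
  have h5 := h2.add h1
  rw [zero_add] at h5
  refine h5.congr fun n => ?_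
  rw [← integral_add]
  · refine integral_congr_ae (Eventually.of_forall fun x => ?_)
    dsimp only
    ring
  · exact ((hLp (d n)).sub (hLp d₀)).bdd_mul (hmeas _) (Eventually.of_forall (hbd _))
  · exact (hLp d₀).bdd_mul (hmeas _) (Eventually.of_forall (hbd _))

/-- A function which is weakly orthogonal to a total set vanishes almost everywhere. -/
theorem ae_eq_zero_of_forall_inner_mem {H : Type*} [NormedAddCommGroup H] [InnerProductSpace ℝ H]
    [CompleteSpace H] {F : α → H} (hF : AEStronglyMeasurable F μ) {s : Set H}
    (hs : ∀ k, (∀ h ∈ s, ⟪h, k⟫_ℝ = 0) → k = 0)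
    (h0 : ∀ h ∈ s, ∀ᵐ x ∂μ, ⟪h, F x⟫_ℝ = 0) : F =ᵐ[μ] 0 := by
  let Z : Submodule ℝ H :=
    { carrier := {h | ∀ᵐ x ∂μ, ⟪h, F x⟫_ℝ = 0}
      zero_mem' := by simp
      add_mem' := fun {a b} (ha : ∀ᵐ x ∂μ, ⟪a, F x⟫_ℝ = 0) (hb : ∀ᵐ x ∂μ, ⟪b, F x⟫_ℝ = 0) => by
        change ∀ᵐ x ∂μ, ⟪a + b, F x⟫_ℝ = 0
        filter_upwards [ha, hb] with x hx hy
        rw [inner_add_left, hx, hy, add_zero]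
      smul_mem' := fun c a (ha : ∀ᵐ x ∂μ, ⟪a, F x⟫_ℝ = 0) => by
        change ∀ᵐ x ∂μ, ⟪c • a, F x⟫_ℝ = 0
        filter_upwards [ha] with x hx
        rw [real_inner_smul_left, hx, mul_zero] }
  have hZd : Z.topologicalClosure = ⊤ := by
    rw [Submodule.topologicalClosure_eq_top_iff, Submodule.eq_bot_iff]
    exact fun k hk => hs k fun h hh => hk h (h0 h hh)
  have hZ (h : H) : ∀ᵐ x ∂μ, ⟪h, F x⟫_ℝ = 0 := by
    have hh : h ∈ closure (Z : Set H) := by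
      rw [← Submodule.topologicalClosure_coe, hZd]
      trivial
    obtain ⟨v, hv, hvh⟩ := mem_closure_iff_seq_limit.1 hh
    have : ∀ᵐ x ∂μ, ∀ n, ⟪v n, F x⟫_ℝ = 0 := ae_all_iff.2 hv
    filter_upwards [this] with x hx
    refine tendsto_nhds_unique (hvh.inner tendsto_const_nhds) ?_
    simp only [hx, tendsto_const_nhds]
  -- `H` is not assumed separable; the range of a strongly measurable representative of `F` is.
  have hsep := hF.stronglyMeasurable_mk.isSeparable_range
  refine ae_eq_zero_of_forall_dual_of_isSeparable ℝ hsep (fun c => ?_) ?_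
  · filter_upwards [hZ ((InnerProductSpace.toDual ℝ H).symm c)] with x hx
    simpa using hx
  · filter_upwards [hF.ae_eq_mk] with x hx
    exact ⟨x, hx.symm⟩

end Limits

/-! ### Regularisations of `t ↦ e⁻ᵗ` -/

section Regularisation

/-- The function `t ↦ (δ + eᵗ)⁻¹`, a bounded approximation of `t ↦ e⁻ᵗ`. -/
def expApprox (δ t : ℝ) : ℝ := (δ + Real.exp t)⁻¹

variable {δ : ℝ}

theorem hasDerivAt_expApprox (hδ : 0 ≤ δ) (t : ℝ) :
    HasDerivAt (expApprox δ) (-Real.exp t / (δ + Real.exp t) ^ 2) t :=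
  ((Real.hasDerivAt_exp t).const_add δ).inv (by positivity)

/-- Together with `expApprox_le_exp`, this bounds both the approximation and its derivative by `e⁻ᵗ`
uniformly in `δ`, which provides the majorant as `δ → 0`. -/
theorem abs_deriv_expApprox_le (hδ : 0 ≤ δ) (t : ℝ) : |deriv (expApprox δ) t| ≤ expApprox δ t := by
  have he := Real.exp_pos t
  rw [(hasDerivAt_expApprox hδ t).deriv, abs_div, abs_neg, abs_of_pos he,
    abs_of_nonneg (by positivity), expApprox, inv_eq_one_div, div_le_div_iff₀ (by positivity)
    (by positivity)]
  nlinarith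

theorem expApprox_nonneg (hδ : 0 ≤ δ) (t : ℝ) : 0 ≤ expApprox δ t := by
  have he := Real.exp_pos t
  unfold expApprox
  positivity

theorem expApprox_le_inv (hδ : 0 < δ) (t : ℝ) : expApprox δ t ≤ δ⁻¹ :=
  inv_anti₀ hδ (by linarith [Real.exp_pos t])

theorem expApprox_le_exp (hδ : 0 ≤ δ) (t : ℝ) : expApprox δ t ≤ Real.exp (-t) := by
  rw [Real.exp_neg]
  exact inv_anti₀ (Real.exp_pos t) (by linarith)

theorem isC1Bounded_expApprox (hδ : 0 < δ) : IsC1Bounded (expApprox δ) := by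
  refine IsC1Bounded.of_deriv (C := δ⁻¹) (D := δ⁻¹) ?_ (fun t => ?_) fun t => ?_
  · exact (contDiff_const.add Real.contDiff_exp).inv fun t => by
      have := Real.exp_pos t
      positivity
  · rw [abs_of_nonneg (expApprox_nonneg hδ.le t)]
    exact expApprox_le_inv hδ t
  · exact (abs_deriv_expApprox_le hδ.le t).trans (expApprox_le_inv hδ t)

theorem tendsto_expApprox (t : ℝ) :
    Tendsto (fun n : ℕ => expApprox (1 / (n + 1)) t) atTop (𝓝 (Real.exp (-t))) := by
  rw [Real.exp_neg]
  have h := (tendsto_one_div_add_atTop_nhds_zero_nat (𝕜 := ℝ)).add_const (Real.exp t)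
  rw [zero_add] at h
  exact h.inv₀ (Real.exp_ne_zero t)

theorem tendsto_deriv_expApprox (t : ℝ) :
    Tendsto (fun n : ℕ => deriv (expApprox (1 / (n + 1))) t) atTop (𝓝 (-Real.exp (-t))) := by
  have h := (tendsto_one_div_add_atTop_nhds_zero_nat (𝕜 := ℝ)).add_const (Real.exp t)
  have h2 := (tendsto_const_nhds (x := -Real.exp t)).div (h.pow 2) (by positivity)
  rw [zero_add, neg_div, pow_two, ← div_div, div_self (Real.exp_ne_zero t), one_div,
    ← Real.exp_neg] at h2
  refine h2.congr fun n => ?_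
  exact (hasDerivAt_expApprox (by positivity) t).deriv.symm

end Regularisation

/-! ### Weights -/

theorem weightedMeasure_eq {X : Type*} [MeasurableSpace X] {μ : Measure X} {U : X → EReal} {u : X → ℝ}
    (h : ∀ᵐ x ∂μ, (u x : EReal) = U x) :
    weightedMeasure μ U = μ.withDensity fun x => ENNReal.ofReal (Real.exp (-u x)) := by
  refine withDensity_congr_ae ?_
  filter_upwards [h] with x hx
  rw [← hx, ← EReal.coe_neg, EReal.exp_coe]

section Weight

variable {X : Type*} [NormedAddCommGroup X] [NormedSpace ℝ X]

/-- A proper lower semicontinuous convex function has an affine minorant. -/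
theorem exists_affine_le {U : X → EReal} (hbot : ∀ x, U x ≠ ⊥) (hproper : ∃ x, U x ≠ ⊤)
    (hlsc : LowerSemicontinuous U)
    (hconv : Convex ℝ {w : X × ℝ | U w.1 ≤ (w.2 : EReal)}) :
    ∃ (a : StrongDual ℝ X) (c : ℝ), ∀ (x : X) (r : ℝ), U x ≤ r → a x + c ≤ r := by
  obtain ⟨x₀, hx₀⟩ := hproper
  have hr₀ : ((U x₀).toReal : EReal) = U x₀ := EReal.coe_toReal hx₀ (hbot x₀)
  set r₀ := (U x₀).toReal
  have hclosed : IsClosed {w : X × ℝ | U w.1 ≤ (w.2 : EReal)} :=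
    hlsc.isClosed_epigraph.preimage (f := fun w : X × ℝ => (w.1, (w.2 : EReal)))
      (continuous_fst.prodMk (continuous_coe_real_ereal.comp continuous_snd))
  have hnot : (x₀, r₀ - 1) ∉ {w : X × ℝ | U w.1 ≤ (w.2 : EReal)} := by
    simp only [Set.mem_ofPred_eq, ← hr₀, EReal.coe_le_coe_iff, not_le]
    linarith
  obtain ⟨f, s, hs, hf⟩ := geometric_hahn_banach_point_closed hconv hclosed hnot
  have hsplit (x : X) (r : ℝ) : f (x, r) = f (x, 0) + r * f (0, 1) := by
    rw [← smul_eq_mul, ← map_smul, ← map_add]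
    simp
  have h1 := hf (x₀, r₀) hr₀.ge
  rw [hsplit] at h1 hs
  -- The separated points `(x₀, r₀ - 1)` and `(x₀, r₀)` differ only vertically, so the separating
  -- hyperplane is not vertical and is the graph of an affine function.
  have hpos : 0 < f (0, 1) := by nlinarith
  refine ⟨-(f (0, 1))⁻¹ • (f ∘L ContinuousLinearMap.inl ℝ X ℝ), (f (0, 1))⁻¹ * s, fun x r hx => ?_⟩
  have h2 := hf (x, r) hx
  rw [hsplit] at h2
  have h3 : (-(f (0, 1))⁻¹ • (f ∘L ContinuousLinearMap.inl ℝ X ℝ)) x + (f (0, 1))⁻¹ * s =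
      (f (0, 1))⁻¹ * (s - f (x, 0)) := by
    simp
    ring
  rw [h3, inv_mul_le_iff₀ hpos]
  linarith

variable [MeasurableSpace X] [BorelSpace X]

theorem memLp_exp_neg {μ : Measure X} [ProbabilityTheory.IsGaussian μ] {u : X → ℝ}
    (hu : AEStronglyMeasurable u μ) {a : StrongDual ℝ X} {c : ℝ}
    (h : ∀ᵐ x ∂μ, a x + c ≤ u x) : MemLp (fun x => Real.exp (-u x)) 2 μ := by
  have hm : AEStronglyMeasurable (fun x => Real.exp (-u x)) μ :=
    Real.continuous_exp.comp_aestronglyMeasurable hu.neg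
  rw [memLp_two_iff_integrable_sq hm]
  refine ((integrable_exp_dual μ (-(2 : ℝ) • a)).const_mul (Real.exp (-2 * c))).mono' (hm.pow 2) ?_
  filter_upwards [h] with x hx
  rw [Real.norm_of_nonneg (by positivity), ← Real.exp_nat_mul, ← Real.exp_add]
  refine Real.exp_le_exp.2 ?_
  simp
  linarith

end Weight

/-! ### Integration by parts for weighted measures -/

section WeightedIBP

variable {X : Type*} [NormedAddCommGroup X] [NormedSpace ℝ X] [CompleteSpace X]
  [SecondCountableTopology X] [MeasurableSpace X] [BorelSpace X] {Q : NonnegSymmOp X}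
  {μ : Measure X} {R : StrongDual ℝ X → X}

omit [SecondCountableTopology X] [MeasurableSpace X] [BorelSpace X] in
theorem inner_gradient (f : X → ℝ) (x : X) (h : KernelSpace Q) :
    ⟪h, gradient Q f x⟫_ℝ = fderiv ℝ f x (inclusion Q h) := by
  rw [gradient, real_inner_comm, inner_inclusionAdj]

/-- For cylindrical `v` this is Gaussian integration by parts for `f · θ(v)`. Because the direction
`R η` lies in `H`, the derivative of `v` along it is `[h, D_H v]`, which passes to limits of
cylindrical functions. Only a pair in the closure of the graph is used, so closability with respect
to `μ` is not needed. -/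
theorem IsCenteredGaussian.integral_fderiv_comp (hμ : IsCenteredGaussian μ R) {p : ℝ≥0∞}
    [Fact (1 ≤ p)] (hp : p ≠ ∞) {h : KernelSpace Q} {η : StrongDual ℝ X}
    (hh : inclusion Q h = R η) {w : Lp ℝ p μ × Lp (KernelSpace Q) p μ}
    (hw : w ∈ (gradientGraph Q p μ).topologicalClosure) {f : X → ℝ} (hf : IsC1Bounded f)
    {θ : ℝ → ℝ} (hθ : IsC1Bounded θ) :
    ∫ x, fderiv ℝ f x (R η) * θ (w.1 x) ∂μ + ∫ x, f x * deriv θ (w.1 x) * ⟪h, w.2 x⟫_ℝ ∂μ =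
      ∫ x, f x * θ (w.1 x) * η x ∂μ := by
  have := hμ.gaussian
  obtain ⟨M, hM⟩ := hf.bounded
  obtain ⟨M', hM'⟩ := hf.bounded_fderiv
  obtain ⟨C, hC⟩ := hθ.bounded
  obtain ⟨C', hC'⟩ := hθ.bounded_fderiv
  have hfc := hf.continuous
  have hfd : Continuous fun x => fderiv ℝ f x (R η) := hf.continuous_fderiv.clm_apply (by fun_prop)
  have hfdb (x : X) : ‖fderiv ℝ f x (R η)‖ ≤ M' * ‖R η‖ :=
    (fderiv ℝ f x).le_of_opNorm_le (hM' x) _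
  have hθd : Continuous (deriv θ) := hθ.contDiff.continuous_deriv le_rfl
  have hθdb (t : ℝ) : ‖deriv θ t‖ ≤ C' := by rw [norm_deriv_eq_norm_fderiv]; exact hC' t
  let T : Lp (KernelSpace Q) p μ →L[ℝ] Lp ℝ p μ := (innerSL ℝ h).compLpL p μ
  have hT (G : Lp (KernelSpace Q) p μ) : T G =ᵐ[μ] fun x => ⟪h, G x⟫_ℝ :=
    (innerSL ℝ h).coeFn_compLpL G
  have h1mem : MemLp (fun _ : X => (1 : ℝ)) p μ := memLp_const 1
  have hηmem : MemLp η p μ := ProbabilityTheory.IsGaussian.memLp_dual μ η p hp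
  let one : Lp ℝ p μ := h1mem.toLp
  let η' : Lp ℝ p μ := hηmem.toLp
  have hone : one =ᵐ[μ] fun _ => 1 := h1mem.coeFn_toLp
  have hη' : η' =ᵐ[μ] η := hηmem.coeFn_toLp
  -- All three integrals are brought to the shape required by `tendsto_integral_comp_mul`, with `1`,
  -- `[h, G]` and `η` as elements of `L^p`.
  have hreg (v : Lp ℝ p μ) (G : Lp (KernelSpace Q) p μ) :
      (∫ x, fderiv ℝ f x (R η) * θ (v x) ∂μ + ∫ x, f x * deriv θ (v x) * ⟪h, G x⟫_ℝ ∂μ =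
        ∫ x, f x * θ (v x) * η x ∂μ) ↔
      ∫ x, fderiv ℝ f x (R η) * θ (v x) * one x ∂μ + ∫ x, f x * deriv θ (v x) * T G x ∂μ =
        ∫ x, f x * θ (v x) * η' x ∂μ := by
    have e1 : ∫ x, fderiv ℝ f x (R η) * θ (v x) * one x ∂μ =
        ∫ x, fderiv ℝ f x (R η) * θ (v x) ∂μ := by
      refine integral_congr_ae ?_
      filter_upwards [hone] with x hx
      rw [hx, mul_one]
    have e2 : ∫ x, f x * deriv θ (v x) * T G x ∂μ =
        ∫ x, f x * deriv θ (v x) * ⟪h, G x⟫_ℝ ∂μ := by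
      refine integral_congr_ae ?_
      filter_upwards [hT G] with x hx
      rw [hx]
    have e3 : ∫ x, f x * θ (v x) * η' x ∂μ = ∫ x, f x * θ (v x) * η x ∂μ := by
      refine integral_congr_ae ?_
      filter_upwards [hη'] with x hx
      rw [hx]
    rw [e1, e2, e3]
  obtain ⟨W, hW, hWlim⟩ := mem_closure_iff_seq_limit.1 hw
  have hW1 : Tendsto (fun n => (W n).1) atTop (𝓝 w.1) := (continuous_fst.tendsto _).comp hWlim
  have hW2 : Tendsto (fun n => T (W n).2) atTop (𝓝 (T w.2)) :=
    (T.continuous.tendsto _).comp ((continuous_snd.tendsto _).comp hWlim)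
  rw [hreg]
  refine tendsto_nhds_unique ((tendsto_integral_comp_mul hW1 tendsto_const_nhds
    hfd.aestronglyMeasurable hfdb hθ.continuous hC).add (tendsto_integral_comp_mul hW1 hW2
    hfc.aestronglyMeasurable hM hθd hθdb)) ?_
  refine (tendsto_integral_comp_mul hW1 tendsto_const_nhds
    hfc.aestronglyMeasurable hM hθ.continuous hC).congr fun n => ?_
  rw [eq_comm, ← hreg]
  obtain ⟨v, hv, hv1, hv2⟩ := hW n
  have hvb := hv.isC1Bounded
  have key := hμ.integral_fderiv (hf.mul (hθ.comp hvb)) η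
  have e1 : ∫ x, fderiv ℝ f x (R η) * θ ((W n).1 x) ∂μ = ∫ x, fderiv ℝ f x (R η) * θ (v x) ∂μ := by
    refine integral_congr_ae ?_
    filter_upwards [hv1] with x hx
    rw [hx]
  have e2 : ∫ x, f x * deriv θ ((W n).1 x) * ⟪h, (W n).2 x⟫_ℝ ∂μ =
      ∫ x, f x * deriv θ (v x) * fderiv ℝ v x (R η) ∂μ := by
    refine integral_congr_ae ?_
    filter_upwards [hv1, hv2] with x hx hx2
    rw [hx, hx2, inner_gradient, hh]
  have e3 : ∫ x, f x * θ ((W n).1 x) * η x ∂μ = ∫ x, f x * θ (v x) * η x ∂μ := by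
    refine integral_congr_ae ?_
    filter_upwards [hv1] with x hx
    rw [hx]
  obtain ⟨D, hD⟩ := hvb.bounded_fderiv
  have hvd : Continuous fun x => fderiv ℝ v x (R η) :=
    hvb.continuous_fderiv.clm_apply (by fun_prop)
  have hvc := hvb.continuous
  have hθc := hθ.continuous
  rw [e1, e2, e3, ← key, ← integral_add]
  · refine integral_congr_ae (Eventually.of_forall fun x => ?_)
    simp only [hf.fderiv_mul (hθ.comp hvb), hθ.fderiv_comp hvb, add_apply, smul_apply, smul_eq_mul]
    ring
  · refine Integrable.of_bound (hfd.mul (hθc.comp hvc)).aestronglyMeasurable (M' * ‖R η‖ * C)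
      (Eventually.of_forall fun x => ?_)
    rw [norm_mul]
    exact mul_le_mul (hfdb x) (hC _) (norm_nonneg _) ((norm_nonneg _).trans (hfdb x))
  · refine Integrable.of_bound ((hfc.mul (hθd.comp hvc)).mul hvd).aestronglyMeasurable
      (M * C' * (D * ‖R η‖)) (Eventually.of_forall fun x => ?_)
    rw [norm_mul, norm_mul]
    have hM0 := (norm_nonneg _).trans (hM x)
    have hC0 := (norm_nonneg _).trans (hθdb 0)
    exact mul_le_mul (mul_le_mul (hM x) (hθdb _) (norm_nonneg _) hM0)
      ((fderiv ℝ v x).le_of_opNorm_le (hD x) _) (norm_nonneg _) (by positivity)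

/-- Take `θ = expApprox δ` and let `δ → 0`. The majorants are `e^{-w}` times `1`, `[h, D_H w]` or
`η`, integrable since `e^{-w}` and, for `p ≥ 2`, the other factors lie in `L²(μ)`. -/
theorem IsCenteredGaussian.integral_fderiv_exp (hμ : IsCenteredGaussian μ R) {p : ℝ≥0∞}
    [Fact (1 ≤ p)] (hp : p ≠ ∞) (hp2 : 2 ≤ p) {h : KernelSpace Q} {η : StrongDual ℝ X}
    (hh : inclusion Q h = R η) {w : Lp ℝ p μ × Lp (KernelSpace Q) p μ}
    (hw : w ∈ (gradientGraph Q p μ).topologicalClosure)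
    (hexp : MemLp (fun x => Real.exp (-w.1 x)) 2 μ) {f : X → ℝ} (hf : IsC1Bounded f) :
    ∫ x, Real.exp (-w.1 x) * fderiv ℝ f x (R η) ∂μ =
      ∫ x, Real.exp (-w.1 x) * (f x * (⟪h, w.2 x⟫_ℝ + η x)) ∂μ := by
  have := hμ.gaussian
  obtain ⟨M, hM⟩ := hf.bounded
  obtain ⟨M', hM'⟩ := hf.bounded_fderiv
  have hfc := hf.continuous
  have hfd : Continuous fun x => fderiv ℝ f x (R η) := hf.continuous_fderiv.clm_apply (by fun_prop)
  have hfdb (x : X) : ‖fderiv ℝ f x (R η)‖ ≤ M' * ‖R η‖ :=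
    (fderiv ℝ f x).le_of_opNorm_le (hM' x) _
  have hw1 : AEStronglyMeasurable w.1 μ := Lp.aestronglyMeasurable w.1
  have hd : MemLp (fun x => ⟪h, w.2 x⟫_ℝ) 2 μ := ((Lp.memLp w.2).mono_exponent hp2).const_inner h
  have hη : MemLp η 2 μ := ProbabilityTheory.IsGaussian.memLp_dual μ η 2 (by simp)
  have hI1 : Integrable (fun x => Real.exp (-w.1 x)) μ := hexp.integrable (by simp)
  have hI2 : Integrable (fun x => Real.exp (-w.1 x) * ⟪h, w.2 x⟫_ℝ) μ := hexp.integrable_mul hd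
  have hI3 : Integrable (fun x => Real.exp (-w.1 x) * η x) μ := hexp.integrable_mul hη
  have hδ (n : ℕ) : (0 : ℝ) < 1 / (n + 1) := by positivity
  have hlim {k ψ₀ : X → ℝ} (hk : AEStronglyMeasurable k μ) {N : ℝ} (hN : ∀ x, ‖k x‖ ≤ N)
      {ψ : ℕ → ℝ → ℝ} (hψ : ∀ n, Continuous (ψ n)) (hψb : ∀ n t, ‖ψ n t‖ ≤ Real.exp (-t))
      (hψl : ∀ x, Tendsto (fun n => ψ n (w.1 x)) atTop (𝓝 (ψ₀ x)))
      {d : X → ℝ} (hdm : AEStronglyMeasurable d μ)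
      (hdi : Integrable (fun x => Real.exp (-w.1 x) * d x) μ) :
      Tendsto (fun n => ∫ x, k x * ψ n (w.1 x) * d x ∂μ) atTop
        (𝓝 (∫ x, k x * ψ₀ x * d x ∂μ)) := by
    refine tendsto_integral_of_dominated_convergence
      (fun x => N * ‖Real.exp (-w.1 x) * d x‖)
      (fun n => (hk.mul ((hψ n).comp_aestronglyMeasurable hw1)).mul hdm) (hdi.norm.const_mul N)
      (fun n => Eventually.of_forall fun x => ?_) (Eventually.of_forall fun x => ?_)
    · rw [mul_assoc, norm_mul, norm_mul, norm_mul, Real.norm_of_nonneg (Real.exp_pos _).le]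
      gcongr
      · exact (norm_nonneg _).trans (hN x)
      · exact hN x
      · exact hψb n _
    · exact ((hψl x).const_mul _).mul_const _
  have hb1 (n : ℕ) (t : ℝ) : ‖expApprox (1 / (n + 1)) t‖ ≤ Real.exp (-t) := by
    rw [Real.norm_of_nonneg (expApprox_nonneg (hδ n).le t)]
    exact expApprox_le_exp (hδ n).le t
  have hb2 (n : ℕ) (t : ℝ) : ‖deriv (expApprox (1 / (n + 1))) t‖ ≤ Real.exp (-t) :=
    (abs_deriv_expApprox_le (hδ n).le t).trans (expApprox_le_exp (hδ n).le t)
  have L1 := hlim hfd.aestronglyMeasurable hfdb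
    (fun n => (isC1Bounded_expApprox (hδ n)).continuous) hb1 (fun x => tendsto_expApprox (w.1 x))
    (d := fun _ => 1) aestronglyMeasurable_const (by simpa using hI1)
  have L2 := hlim hfc.aestronglyMeasurable hM
    (fun n => (isC1Bounded_expApprox (hδ n)).contDiff.continuous_deriv le_rfl) hb2
    (fun x => tendsto_deriv_expApprox (w.1 x)) hd.aestronglyMeasurable hI2
  have L3 := hlim hfc.aestronglyMeasurable hM
    (fun n => (isC1Bounded_expApprox (hδ n)).continuous) hb1 (fun x => tendsto_expApprox (w.1 x))
    hη.aestronglyMeasurable hI3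
  have key := tendsto_nhds_unique (L1.add L2) (L3.congr fun n => by
    simpa only [mul_one] using
      (hμ.integral_fderiv_comp hp hh hw hf (isC1Bounded_expApprox (hδ n))).symm)
  have hJ2 : Integrable (fun x => f x * (Real.exp (-w.1 x) * ⟪h, w.2 x⟫_ℝ)) μ :=
    hI2.bdd_mul hfc.aestronglyMeasurable (Eventually.of_forall hM)
  have hJ3 : Integrable (fun x => f x * (Real.exp (-w.1 x) * η x)) μ :=
    hI3.bdd_mul hfc.aestronglyMeasurable (Eventually.of_forall hM)
  have e1 : ∫ x, Real.exp (-w.1 x) * (f x * (⟪h, w.2 x⟫_ℝ + η x)) ∂μ =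
      ∫ x, f x * (Real.exp (-w.1 x) * ⟪h, w.2 x⟫_ℝ) ∂μ +
        ∫ x, f x * (Real.exp (-w.1 x) * η x) ∂μ := by
    rw [← integral_add hJ2 hJ3]
    refine integral_congr_ae (Eventually.of_forall fun x => ?_)
    dsimp only
    ring
  simp only [mul_one, mul_neg, neg_mul, integral_neg, mul_assoc] at key
  rw [e1]
  simp only [mul_comm (Real.exp _) (fderiv ℝ f _ _)]
  linarith

end WeightedIBP

/-! ### Closability of the gradient for weighted measures -/

section Closability

variable {X : Type*} [MeasurableSpace X] {μ : Measure X} {u : X → ℝ}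

/-- The measure `e⁻ᵘ μ` for a real valued function `u`. -/
def expMeasure (μ : Measure X) (u : X → ℝ) : Measure X :=
  μ.withDensity fun x => ENNReal.ofReal (Real.exp (-u x))

theorem expMeasure_absolutelyContinuous : expMeasure μ u ≪ μ :=
  withDensity_absolutelyContinuous _ _

theorem aemeasurable_ofReal_exp_neg (hu : AEStronglyMeasurable u μ) :
    AEMeasurable (fun x => ENNReal.ofReal (Real.exp (-u x))) μ :=
  (Real.measurable_exp.comp_aemeasurable hu.aemeasurable.neg).ennreal_ofReal

theorem integral_expMeasure (hu : AEStronglyMeasurable u μ) (g : X → ℝ) :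
    ∫ x, g x ∂(expMeasure μ u) = ∫ x, Real.exp (-u x) * g x ∂μ := by
  rw [expMeasure, integral_withDensity_eq_integral_toReal_smul₀ (aemeasurable_ofReal_exp_neg hu)
    (by simp)]
  simp only [ENNReal.toReal_ofReal (Real.exp_pos _).le, smul_eq_mul]

theorem integrable_expMeasure_iff (hu : AEStronglyMeasurable u μ) {g : X → ℝ} :
    Integrable g (expMeasure μ u) ↔ Integrable (fun x => Real.exp (-u x) * g x) μ := by
  rw [expMeasure, integrable_withDensity_iff_integrable_smul₀' (aemeasurable_ofReal_exp_neg hu)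
    (by simp)]
  simp only [ENNReal.toReal_ofReal (Real.exp_pos _).le, smul_eq_mul]

theorem isFiniteMeasure_expMeasure (hexp : Integrable (fun x => Real.exp (-u x)) μ) :
    IsFiniteMeasure (expMeasure μ u) :=
  isFiniteMeasure_withDensity hexp.lintegral_lt_top.ne

/-- `e^{-u}` and `g²` are both in `L²(μ)`, so `e^{-u} g²` is integrable. This is the source of the
exponent `4`. -/
theorem memLp_expMeasure (hu : AEStronglyMeasurable u μ)
    (hexp : MemLp (fun x => Real.exp (-u x)) 2 μ) {g : X → ℝ} (hg : MemLp g 4 μ) :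
    MemLp g 2 (expMeasure μ u) := by
  rw [memLp_two_iff_integrable_sq (hg.aestronglyMeasurable.mono_ac expMeasure_absolutelyContinuous),
    integrable_expMeasure_iff hu]
  have h4 : ENNReal.HolderTriple 4 4 2 := ⟨by
    rw [← two_mul, show (4 : ℝ≥0∞) = 2 * 2 by norm_num,
      ENNReal.mul_inv (Or.inl (by simp)) (Or.inl (by simp)), ← mul_assoc,
      ENNReal.mul_inv_cancel (by simp) (by simp), one_mul]⟩
  have h2 : MemLp (fun x => g x ^ 2) 2 μ := by
    simp only [pow_two]
    exact hg.mul hg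
  exact hexp.integrable_mul h2

/-- Both sides are `L²` pairings with fixed functions `g` and `K`, so equality is a closed condition
on the pair. -/
theorem integral_mul_inner_of_mem_topologicalClosure {H : Type*} [NormedAddCommGroup H]
    [InnerProductSpace ℝ H] [CompleteSpace H] {ν : Measure X}
    {Γ : Submodule ℝ (Lp ℝ 2 ν × Lp H 2 ν)} {h : H} {g K : X → ℝ} (hg : MemLp g 2 ν)
    (hK : MemLp K 2 ν)
    (hΓ : ∀ z ∈ Γ, ∫ x, g x * ⟪h, z.2 x⟫_ℝ ∂ν = ∫ x, K x * z.1 x ∂ν)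
    {v : Lp ℝ 2 ν × Lp H 2 ν} (hv : v ∈ Γ.topologicalClosure) :
    ∫ x, g x * ⟪h, v.2 x⟫_ℝ ∂ν = ∫ x, K x * v.1 x ∂ν := by
  let T : Lp H 2 ν →L[ℝ] Lp ℝ 2 ν := (innerSL ℝ h).compLpL 2 ν
  have hT (G : Lp H 2 ν) : ⟪hg.toLp, T G⟫_ℝ = ∫ x, g x * ⟪h, G x⟫_ℝ ∂ν := by
    rw [L2.inner_def]
    refine integral_congr_ae ?_
    filter_upwards [(innerSL ℝ h).coeFn_compLpL (p := 2) (μ := ν) G, hg.coeFn_toLp] with x h1 h2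
    rw [h1, h2]
    simp [mul_comm]
  have hK' (f : Lp ℝ 2 ν) : ⟪hK.toLp, f⟫_ℝ = ∫ x, K x * f x ∂ν := by
    rw [L2.inner_def]
    refine integral_congr_ae ?_
    filter_upwards [hK.coeFn_toLp] with x h1
    rw [h1]
    simp [mul_comm]
  have hclosed : IsClosed {z : Lp ℝ 2 ν × Lp H 2 ν | ⟪hg.toLp, T z.2⟫_ℝ = ⟪hK.toLp, z.1⟫_ℝ} :=
    isClosed_eq (by fun_prop) (by fun_prop)
  have hsub : (Γ : Set (Lp ℝ 2 ν × Lp H 2 ν)) ⊆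
      {z | ⟪hg.toLp, T z.2⟫_ℝ = ⟪hK.toLp, z.1⟫_ℝ} := fun z hz =>
    (hT z.2).trans ((hΓ z hz).trans (hK' z.1).symm)
  exact (hT v.2).symm.trans ((closure_minimal hsub hclosed hv : _ = _).trans (hK' v.1))

variable [NormedAddCommGroup X] [NormedSpace ℝ X] [CompleteSpace X]
  [SecondCountableTopology X] [BorelSpace X] {Q : NonnegSymmOp X} {R : StrongDual ℝ X → X}

instance : Fact ((1 : ℝ≥0∞) ≤ 4) := ⟨by norm_num⟩

/-- Integration by parts against the gradient of a cylindrical function. -/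
theorem IsCenteredGaussian.integral_mul_fderiv_exp (hμ : IsCenteredGaussian μ R)
    {h : KernelSpace Q} {η : StrongDual ℝ X} (hh : inclusion Q h = R η)
    {w : Lp ℝ 4 μ × Lp (KernelSpace Q) 4 μ} (hw : w ∈ (gradientGraph Q 4 μ).topologicalClosure)
    (hexp : MemLp (fun x => Real.exp (-w.1 x)) 2 μ) {f g : X → ℝ} (hf : IsC1Bounded f)
    (hg : IsC1Bounded g) :
    ∫ x, g x * fderiv ℝ f x (R η) ∂(expMeasure μ w.1) =
      ∫ x, (g x * (⟪h, w.2 x⟫_ℝ + η x) - fderiv ℝ g x (R η)) * f x ∂(expMeasure μ w.1) := by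
  have := hμ.gaussian
  have hu : AEStronglyMeasurable w.1 μ := Lp.aestronglyMeasurable w.1
  have hd : MemLp (fun x => ⟪h, w.2 x⟫_ℝ) 2 μ :=
    ((Lp.memLp w.2).mono_exponent (p := 2) (q := 4) (by norm_num)).const_inner h
  have hη : MemLp η 2 μ := ProbabilityTheory.IsGaussian.memLp_dual μ η 2 (by simp)
  have hI1 : Integrable (fun x => Real.exp (-w.1 x)) μ := hexp.integrable (by simp)
  have hI2 : Integrable (fun x => Real.exp (-w.1 x) * (⟪h, w.2 x⟫_ℝ + η x)) μ :=
    hexp.integrable_mul (hd.add hη)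
  have hbdd {k l : X → ℝ} (hk : IsC1Bounded k) (hl : IsC1Bounded l) :
      Continuous (fun x => k x * fderiv ℝ l x (R η)) ∧
        ∃ C, ∀ x, ‖k x * fderiv ℝ l x (R η)‖ ≤ C := by
    obtain ⟨M, hM⟩ := hk.bounded
    obtain ⟨D, hD⟩ := hl.bounded_fderiv
    refine ⟨hk.continuous.mul (hl.continuous_fderiv.clm_apply continuous_const),
      M * (D * ‖R η‖), fun x => ?_⟩
    rw [norm_mul]
    exact mul_le_mul (hM x) ((fderiv ℝ l x).le_of_opNorm_le (hD x) _) (norm_nonneg _)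
      ((norm_nonneg _).trans (hM x))
  obtain ⟨c1, C1, hC1⟩ := hbdd hg hf
  obtain ⟨c2, C2, hC2⟩ := hbdd hf hg
  have hJ1 : Integrable (fun x => Real.exp (-w.1 x) * (g x * fderiv ℝ f x (R η))) μ :=
    hI1.mul_bdd c1.aestronglyMeasurable (Eventually.of_forall hC1)
  have hJ2 : Integrable (fun x => Real.exp (-w.1 x) * (f x * fderiv ℝ g x (R η))) μ :=
    hI1.mul_bdd c2.aestronglyMeasurable (Eventually.of_forall hC2)
  obtain ⟨C3, hC3⟩ := (hf.mul hg).bounded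
  have hJ3 : Integrable
      (fun x => f x * g x * (Real.exp (-w.1 x) * (⟪h, w.2 x⟫_ℝ + η x))) μ :=
    hI2.bdd_mul (hf.mul hg).continuous.aestronglyMeasurable (Eventually.of_forall hC3)
  have key := hμ.integral_fderiv_exp (by simp) (by norm_num) hh hw hexp (hf.mul hg)
  rw [integral_expMeasure hu, integral_expMeasure hu]
  have e1 : ∫ x, Real.exp (-w.1 x) * fderiv ℝ (fun x => f x * g x) x (R η) ∂μ =
      ∫ x, Real.exp (-w.1 x) * (f x * fderiv ℝ g x (R η)) ∂μ +
        ∫ x, Real.exp (-w.1 x) * (g x * fderiv ℝ f x (R η)) ∂μ := by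
    rw [← integral_add hJ2 hJ1]
    refine integral_congr_ae (Eventually.of_forall fun x => ?_)
    simp only [hf.fderiv_mul hg, add_apply, smul_apply, smul_eq_mul]
    ring
  have e2 : ∫ x, Real.exp (-w.1 x) *
      ((g x * (⟪h, w.2 x⟫_ℝ + η x) - fderiv ℝ g x (R η)) * f x) ∂μ =
      ∫ x, f x * g x * (Real.exp (-w.1 x) * (⟪h, w.2 x⟫_ℝ + η x)) ∂μ -
        ∫ x, Real.exp (-w.1 x) * (f x * fderiv ℝ g x (R η)) ∂μ := by
    rw [← integral_sub hJ3 hJ2]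
    refine integral_congr_ae (Eventually.of_forall fun x => ?_)
    dsimp only
    ring
  have e3 : ∫ x, Real.exp (-w.1 x) * (f x * g x * (⟪h, w.2 x⟫_ℝ + η x)) ∂μ =
      ∫ x, f x * g x * (Real.exp (-w.1 x) * (⟪h, w.2 x⟫_ℝ + η x)) ∂μ := by
    refine integral_congr_ae (Eventually.of_forall fun x => ?_)
    dsimp only
    ring
  rw [e1, e3] at key
  rw [e2]
  linarith

omit [CompleteSpace X] [SecondCountableTopology X] in
theorem IsCenteredGaussian.memLp_mul_sub (hμ : IsCenteredGaussian μ R) {d : X → ℝ}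
    (hd : MemLp d 4 μ) (η : StrongDual ℝ X) {g : X → ℝ} (hg : IsC1Bounded g) (y : X) :
    MemLp (fun x => g x * (d x + η x) - fderiv ℝ g x y) 4 μ := by
  have := hμ.gaussian
  obtain ⟨M, hM⟩ := hg.bounded
  obtain ⟨D, hD⟩ := hg.bounded_fderiv
  have hgd : Continuous fun x => fderiv ℝ g x y :=
    hg.continuous_fderiv.clm_apply continuous_const
  have h1 : MemLp (fun x => d x + η x) 4 μ := hd.add
    (ProbabilityTheory.IsGaussian.memLp_dual μ η 4 (by simp))
  refine MemLp.sub (h1.of_le_mul (c := M) (hg.continuous.aestronglyMeasurable.mul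
    h1.aestronglyMeasurable) (Eventually.of_forall fun x => ?_))
    (MemLp.of_bound hgd.aestronglyMeasurable (D * ‖y‖) (Eventually.of_forall fun x =>
      (fderiv ℝ g x).le_of_opNorm_le (hD x) _))
  rw [norm_mul]
  gcongr
  exact hM x

/-- If `(0, G)` is a limit of pairs `(f, D_H f)`, integration by parts passes to the limit and gives
`∫ g [h, G] dν = 0` for all cylindrical `g` and all `h ∈ s`. Cylindrical functions determine `[h,
G]` and `s` is total, so `G = 0`. -/
theorem IsCenteredGaussian.closable_gradientGraph (hμ : IsCenteredGaussian μ R)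
    {w : Lp ℝ 4 μ × Lp (KernelSpace Q) 4 μ} (hw : w ∈ (gradientGraph Q 4 μ).topologicalClosure)
    (hexp : MemLp (fun x => Real.exp (-w.1 x)) 2 μ) {s : Set (KernelSpace Q)}
    (hs : ∀ k, (∀ h ∈ s, ⟪h, k⟫_ℝ = 0) → k = 0)
    (hsR : ∀ h ∈ s, ∃ η, inclusion Q h = R η) {ν : Measure X} (hν : ν = expMeasure μ w.1)
    {v : Lp ℝ 2 ν × Lp (KernelSpace Q) 2 ν}
    (hv : v ∈ (gradientGraph Q 2 ν).topologicalClosure) (hv0 : v.1 = 0) : v.2 = 0 := by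
  have := hμ.gaussian
  have hu : AEStronglyMeasurable w.1 μ := Lp.aestronglyMeasurable w.1
  have hfin : IsFiniteMeasure ν :=
    hν ▸ isFiniteMeasure_expMeasure (hexp.integrable (by simp))
  rw [Lp.eq_zero_iff_ae_eq_zero]
  refine ae_eq_zero_of_forall_inner_mem (Lp.aestronglyMeasurable v.2) hs fun h hhs => ?_
  obtain ⟨η, hη⟩ := hsR h hhs
  refine ae_eq_zero_of_forall_isCylindrical
    (((Lp.memLp v.2).integrable one_le_two).const_inner h) fun g hg => ?_
  have hgb := hg.isC1Bounded
  obtain ⟨M, hM⟩ := hgb.bounded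
  have hg2 : MemLp g 2 ν := MemLp.of_bound hgb.continuous.aestronglyMeasurable M
    (Eventually.of_forall hM)
  have hK2 : MemLp (fun x => g x * (⟪h, w.2 x⟫_ℝ + η x) - fderiv ℝ g x (R η)) 2 ν :=
    hν ▸ memLp_expMeasure hu hexp (hμ.memLp_mul_sub ((Lp.memLp w.2).const_inner h) η hgb (R η))
  have hfinal := integral_mul_inner_of_mem_topologicalClosure (h := h)
    (Γ := gradientGraph Q 2 ν) hg2 hK2 ?_ hv
  · rw [hfinal]
    refine integral_eq_zero_of_ae ?_
    filter_upwards [(Lp.eq_zero_iff_ae_eq_zero).1 hv0] with x hx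
    rw [hx, Pi.zero_apply, mul_zero]
  · rintro z ⟨f, hf, hz1, hz2⟩
    have key := hμ.integral_mul_fderiv_exp hη hw hexp hf.isC1Bounded hgb
    rw [← hν] at key
    refine Eq.trans (integral_congr_ae ?_) (key.trans (integral_congr_ae ?_))
    · filter_upwards [hz2] with x h1
      rw [h1, inner_gradient, hη]
    · filter_upwards [hz1] with x h1
      rw [h1]

end Closability

/-! ### Operators associated with coercive forms -/

section CoerciveForm

variable {K G : Type*} [NormedAddCommGroup K] [InnerProductSpace ℝ K] [NormedAddCommGroup G]
  [InnerProductSpace ℝ G]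

/-- The graph of the operator associated with the form `⟪C ∇u, ∇v⟫`, where `W` is the graph of
`∇`. -/
def coerciveFormGraph (W : Submodule ℝ (K × G)) (C : G →L[ℝ] G) : Submodule ℝ (K × K) where
  carrier := {w | ∃ p, (w.1, p) ∈ W ∧ ∀ q ∈ W, ⟪C p, q.2⟫_ℝ = ⟪w.2, q.1⟫_ℝ}
  zero_mem' := ⟨0, W.zero_mem, by simp⟩
  add_mem' := by
    rintro a b ⟨p, hp, h⟩ ⟨p', hp', h'⟩
    refine ⟨p + p', W.add_mem hp hp', fun q hq => ?_⟩
    rw [map_add, inner_add_left, h q hq, h' q hq, Prod.snd_add, inner_add_left]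
  smul_mem' := by
    rintro c a ⟨p, hp, h⟩
    refine ⟨c • p, W.smul_mem c hp, fun q hq => ?_⟩
    rw [map_smul, real_inner_smul_left, h q hq, Prod.smul_snd, real_inner_smul_left]

variable {W : Submodule ℝ (K × G)} {C : G →L[ℝ] G}

/-- Each equation is tested with the solution of the other; the form of the adjoint of `C` is the
transposed form. -/
theorem coerciveFormGraph_adjoint [CompleteSpace G] {w w' : K × K}
    (hw : w ∈ coerciveFormGraph W C)
    (hw' : w' ∈ coerciveFormGraph W (ContinuousLinearMap.adjoint C)) :
    ⟪w.2, w'.1⟫_ℝ = ⟪w.1, w'.2⟫_ℝ := by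
  obtain ⟨p, hp, h⟩ := hw
  obtain ⟨p', hp', h'⟩ := hw'
  have h1 := h _ hp'
  have h2 := h' _ hp
  dsimp only at h1 h2
  rw [← h1, real_inner_comm w'.2, ← h2, ContinuousLinearMap.adjoint_inner_left, real_inner_comm]

variable [CompleteSpace K] [CompleteSpace G]

/-- Solvability of the resolvent equation, by the Lax-Milgram theorem. -/
theorem exists_mem_coerciveFormGraph (hW : IsClosed (W : Set (K × G))) {c : ℝ} (hc : 0 < c)
    (hC : ∀ g, ⟪C g, g⟫_ℝ ≤ -(c * ‖g‖ ^ 2)) {r : ℝ} (hr : 0 < r) (g : K) :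
    ∃ u, (u, r • u - g) ∈ coerciveFormGraph W C := by
  -- The product `K × G` carries the sup norm; the `ℓ²` norm turns the closed subspace `W` into a
  -- Hilbert space, as Lax-Milgram requires.
  let V : Submodule ℝ (WithLp 2 (K × G)) :=
    W.comap (WithLp.linearEquiv 2 ℝ (K × G) : WithLp 2 (K × G) →ₗ[ℝ] K × G)
  have hV : IsClosed (V : Set (WithLp 2 (K × G))) :=
    hW.preimage (WithLp.prod_continuous_ofLp 2 K G)
  have : CompleteSpace V := hV.completeSpace_coe
  have hform : IsBoundedBilinearMap ℝ fun z : V × V =>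
      r * ⟪(z.1 : WithLp 2 (K × G)).fst, (z.2 : WithLp 2 (K × G)).fst⟫_ℝ -
        ⟪C (z.1 : WithLp 2 (K × G)).snd, (z.2 : WithLp 2 (K × G)).snd⟫_ℝ :=
    { add_left := fun x y z => by simp [inner_add_left]; ring
      smul_left := fun a x y => by simp [real_inner_smul_left]; ring
      add_right := fun x y z => by simp [inner_add_right]; ring
      smul_right := fun a x y => by simp [real_inner_smul_right]; ring
      bound := by
        refine ⟨r + ‖C‖ + 1, by positivity, fun x y => ?_⟩
        have hx1 : ‖(x : WithLp 2 (K × G)).fst‖ ≤ ‖x‖ := WithLp.norm_fst_le _ (p := 2) _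
        have hx2 : ‖(x : WithLp 2 (K × G)).snd‖ ≤ ‖x‖ := WithLp.norm_snd_le _ (p := 2) _
        have hy1 : ‖(y : WithLp 2 (K × G)).fst‖ ≤ ‖y‖ := WithLp.norm_fst_le _ (p := 2) _
        have hy2 : ‖(y : WithLp 2 (K × G)).snd‖ ≤ ‖y‖ := WithLp.norm_snd_le _ (p := 2) _
        refine (norm_sub_le _ _).trans ?_
        rw [norm_mul, Real.norm_of_nonneg hr.le]
        have h1 : ‖⟪(x : WithLp 2 (K × G)).fst, (y : WithLp 2 (K × G)).fst⟫_ℝ‖ ≤ ‖x‖ * ‖y‖ :=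
          (norm_inner_le_norm _ _).trans (by gcongr)
        have h2 : ‖⟪C (x : WithLp 2 (K × G)).snd, (y : WithLp 2 (K × G)).snd⟫_ℝ‖ ≤
            ‖C‖ * ‖x‖ * ‖y‖ :=
          (norm_inner_le_norm _ _).trans (by
            gcongr
            exact (C.le_opNorm _).trans (by gcongr))
        nlinarith [mul_nonneg (norm_nonneg x) (norm_nonneg y)] }
  let b : V →L[ℝ] V →L[ℝ] ℝ := hform.toContinuousLinearMap
  have hb (x y : V) : b x y = r * ⟪(x : WithLp 2 (K × G)).fst, (y : WithLp 2 (K × G)).fst⟫_ℝ -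
      ⟪C (x : WithLp 2 (K × G)).snd, (y : WithLp 2 (K × G)).snd⟫_ℝ := rfl
  have hcoer : IsCoercive b := by
    refine ⟨min r c, lt_min hr hc, fun x => ?_⟩
    have h1 := hC (x : WithLp 2 (K × G)).snd
    have h2 : ‖x‖ ^ 2 = ‖(x : WithLp 2 (K × G)).fst‖ ^ 2 + ‖(x : WithLp 2 (K × G)).snd‖ ^ 2 :=
      WithLp.prod_norm_sq_eq_of_L2 (x : WithLp 2 (K × G))
    rw [hb, real_inner_self_eq_norm_sq, mul_assoc, ← pow_two, h2]
    nlinarith [mul_le_mul_of_nonneg_right (min_le_left r c)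
      (sq_nonneg ‖(x : WithLp 2 (K × G)).fst‖), mul_le_mul_of_nonneg_right (min_le_right r c)
      (sq_nonneg ‖(x : WithLp 2 (K × G)).snd‖)]
  -- Riesz representative on `V` of the functional `(u, p) ↦ ⟪g, u⟫`.
  let z : V := V.orthogonalProjectionOnto (WithLp.toLp 2 (g, (0 : G)))
  have hz (y : V) : ⟪z, y⟫_ℝ = ⟪g, (y : WithLp 2 (K × G)).fst⟫_ℝ := by
    rw [Submodule.inner_orthogonalProjectionOnto_eq_of_mem_right]
    simp
  obtain ⟨v, hv⟩ : ∃ v : V, ∀ y : V, b v y = ⟪z, y⟫_ℝ :=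
    ⟨hcoer.continuousLinearEquivOfBilin.symm z, fun y => by
      rw [← hcoer.continuousLinearEquivOfBilin_apply, ContinuousLinearEquiv.apply_symm_apply]⟩
  refine ⟨(v : WithLp 2 (K × G)).fst, (v : WithLp 2 (K × G)).snd, v.2, fun q hq => ?_⟩
  have h1 := hv ⟨WithLp.toLp 2 q, hq⟩
  rw [hb, hz] at h1
  simp only [WithLp.toLp_fst, WithLp.toLp_snd] at h1
  rw [inner_sub_left, real_inner_smul_left]
  linarith

theorem isMaximalDissipative_coerciveFormGraph (hW : IsClosed (W : Set (K × G)))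
    (hWd : Dense (Prod.fst '' (W : Set (K × G)))) {c : ℝ} (hc : 0 < c)
    (hC : ∀ g, ⟪C g, g⟫_ℝ ≤ -(c * ‖g‖ ^ 2)) : IsMaximalDissipative (coerciveFormGraph W C) where
  nonpos := by
    rintro w ⟨p, hp, h⟩
    have h1 := h _ hp
    rw [real_inner_comm, ← h1]
    exact (hC p).trans (neg_nonpos.2 (by positivity))
  surj r hr g := exists_mem_coerciveFormGraph hW hc hC hr g
  dense := by
    let D : Submodule ℝ K := (coerciveFormGraph W C).map (LinearMap.fst ℝ K K)
    suffices h : D.topologicalClosure = ⊤ by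
      have := (Submodule.dense_iff_topologicalClosure_eq_top (s := D)).2 h
      exact this
    rw [Submodule.topologicalClosure_eq_top_iff, Submodule.eq_bot_iff]
    intro x hx
    -- For `x` orthogonal to the domain, solve `u - L u = x` and test with `u`: `‖u‖² + c ‖p‖² ≤ ⟪x,
    -- u⟫ = 0`. So `u` and `p` vanish, the equation makes `x` orthogonal to the first components of
    -- `W`, and these are dense.
    obtain ⟨u, hu⟩ := exists_mem_coerciveFormGraph hW hc hC one_pos x
    have h0 : ⟪u, x⟫_ℝ = 0 := hx u ⟨_, hu, rfl⟩
    obtain ⟨p, hp, h⟩ := hu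
    have h1 := h _ hp
    dsimp only at h1
    rw [one_smul, inner_sub_left, real_inner_self_eq_norm_sq, real_inner_comm u x, h0] at h1
    have h2 := hC p
    have hu0 : u = 0 := by
      rw [← norm_eq_zero]
      nlinarith [norm_nonneg u, sq_nonneg ‖p‖, mul_nonneg hc.le (sq_nonneg ‖p‖)]
    have hp0 : p = 0 := by
      rw [← norm_eq_zero, ← sq_eq_zero_iff]
      rw [hu0, norm_zero] at h1
      nlinarith [sq_nonneg ‖p‖]
    refine hWd.eq_zero_of_inner_left ℝ ?_
    rintro _ ⟨q, hq, rfl⟩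
    have h3 := h q hq
    simp only [hp0, hu0, map_zero, inner_zero_left, smul_zero, zero_sub, inner_neg_left] at h3
    linarith

omit [CompleteSpace K] [CompleteSpace G] in
/-- It suffices to test against a graph with closure `W`. -/
theorem mem_coerciveFormGraph_topologicalClosure {Γ : Submodule ℝ (K × G)} {x y : K} {p : G}
    (hp : (x, p) ∈ Γ.topologicalClosure) (h : ∀ q ∈ Γ, ⟪C p, q.2⟫_ℝ = ⟪y, q.1⟫_ℝ) :
    (x, y) ∈ coerciveFormGraph Γ.topologicalClosure C := by
  refine ⟨p, hp, fun q hq => ?_⟩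
  have hclosed : IsClosed {q : K × G | ⟪C p, q.2⟫_ℝ = ⟪y, q.1⟫_ℝ} :=
    isClosed_eq (by fun_prop) (by fun_prop)
  exact closure_minimal (s := (Γ : Set (K × G))) h hclosed hq

theorem IsMaximalDissipative.exists_semigroup {Γ Γ' : Submodule ℝ (K × K)} {L L' : K →ₗ.[ℝ] K}
    (h : IsMaximalDissipative Γ) (h' : IsMaximalDissipative Γ') (hL : L = Γ.toLinearPMap)
    (hL' : L' = Γ'.toLinearPMap)
    (hadj : ∀ w ∈ Γ, ∀ w' ∈ Γ', ⟪w.2, w'.1⟫_ℝ = ⟪w.1, w'.2⟫_ℝ) :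
    L' = L.adjoint ∧ ∃ T T' : ℝ≥0 → K →L[ℝ] K,
      IsContractionSemigroup T ∧ generator T = L ∧ IsContractionSemigroup T' ∧
        generator T' = L' ∧ ∀ t, T' t = ContinuousLinearMap.adjoint (T t) := by
  subst hL hL'
  refine ⟨h.adjoint_toLinearPMap h' hadj, h.semigroup, h'.semigroup,
    h.isContractionSemigroup, ?_, h'.isContractionSemigroup, ?_, h.adjoint_semigroup h' hadj⟩
  · rw [generator, h.generatorGraph_semigroup]
  · rw [generator, h'.generatorGraph_semigroup]

/-- The operators of a bounded coercive form and of the adjoint form are adjoint to each other and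
generate mutually adjoint contraction semigroups. -/
theorem exists_semigroup_coerciveFormGraph (hW : IsClosed (W : Set (K × G)))
    (hWd : Dense (Prod.fst '' (W : Set (K × G)))) {c : ℝ} (hc : 0 < c)
    (hC : ∀ g, ⟪C g, g⟫_ℝ ≤ -(c * ‖g‖ ^ 2)) {L L' : K →ₗ.[ℝ] K}
    (hL : L = (coerciveFormGraph W C).toLinearPMap)
    (hL' : L' = (coerciveFormGraph W (ContinuousLinearMap.adjoint C)).toLinearPMap) :
    L' = L.adjoint ∧ ∃ T T' : ℝ≥0 → K →L[ℝ] K,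
      IsContractionSemigroup T ∧ generator T = L ∧ IsContractionSemigroup T' ∧
        generator T' = L' ∧ ∀ t, T' t = ContinuousLinearMap.adjoint (T t) := by
  have hC' (g : G) : ⟪ContinuousLinearMap.adjoint C g, g⟫_ℝ ≤ -(c * ‖g‖ ^ 2) := by
    rw [ContinuousLinearMap.adjoint_inner_left, real_inner_comm]
    exact hC g
  exact (isMaximalDissipative_coerciveFormGraph hW hWd hc hC).exists_semigroup
    (isMaximalDissipative_coerciveFormGraph hW hWd hc hC') hL hL'
    fun w hw w' hw' => coerciveFormGraph_adjoint hw hw'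

end CoerciveForm

/-! ### The operators `L₂` and `L̃₂` -/

section FormOperator

variable {X : Type*} [NormedAddCommGroup X] [NormedSpace ℝ X] [CompleteSpace X]
  [MeasurableSpace X] {Q : NonnegSymmOp X} {ν : Measure X}

theorem gradientClosure_graph
    (hcl : ∀ v ∈ (gradientGraph Q 2 ν).topologicalClosure, v.1 = 0 → v.2 = 0) :
    (gradientClosure Q 2 ν).graph = (gradientGraph Q 2 ν).topologicalClosure :=
  Submodule.toLinearPMap_graph_eq _ hcl

theorem mk_sobolevGradient_mem
    (hcl : ∀ v ∈ (gradientGraph Q 2 ν).topologicalClosure, v.1 = 0 → v.2 = 0)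
    (u : sobolev Q 2 ν) :
    ((u : Lp ℝ 2 ν), sobolevGradient Q 2 ν u) ∈ (gradientGraph Q 2 ν).topologicalClosure := by
  rw [← gradientClosure_graph hcl]
  exact LinearPMap.mem_graph _ u

theorem sobolevGradient_eq
    (hcl : ∀ v ∈ (gradientGraph Q 2 ν).topologicalClosure, v.1 = 0 → v.2 = 0)
    (u : sobolev Q 2 ν) {p : Lp (KernelSpace Q) 2 ν}
    (h : ((u : Lp ℝ 2 ν), p) ∈ (gradientGraph Q 2 ν).topologicalClosure) :
    sobolevGradient Q 2 ν u = p :=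
  sub_eq_zero.1 (hcl _ (Submodule.sub_mem _ (mk_sobolevGradient_mem hcl u) h) (sub_self _))

theorem exists_sobolevGradient_eq
    (hcl : ∀ v ∈ (gradientGraph Q 2 ν).topologicalClosure, v.1 = 0 → v.2 = 0)
    {x : Lp ℝ 2 ν} {p : Lp (KernelSpace Q) 2 ν}
    (h : (x, p) ∈ (gradientGraph Q 2 ν).topologicalClosure) :
    ∃ u : sobolev Q 2 ν, (u : Lp ℝ 2 ν) = x ∧ sobolevGradient Q 2 ν u = p := by
  have hx : x ∈ sobolev Q 2 ν := ⟨(x, p), h, rfl⟩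
  exact ⟨⟨x, hx⟩, rfl, sobolevGradient_eq hcl ⟨x, hx⟩ h⟩

omit [NormedAddCommGroup X] [NormedSpace ℝ X] [CompleteSpace X] in
theorem integral_mul_eq_inner (g v : Lp ℝ 2 ν) : ∫ x, g x * v x ∂ν = ⟪g, v⟫_ℝ := by
  rw [L2.inner_def]
  refine integral_congr_ae (Eventually.of_forall fun x => ?_)
  simp [mul_comm]

theorem form_eq_neg_integral_iff (C : KernelSpace Q →L[ℝ] KernelSpace Q) (u v : sobolev Q 2 ν)
    (y : Lp ℝ 2 ν) :
    form Q ν C u v = -∫ x, y x * (v : Lp ℝ 2 ν) x ∂ν ↔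
      ⟪C.compLpL 2 ν (sobolevGradient Q 2 ν u), sobolevGradient Q 2 ν v⟫_ℝ =
        ⟪y, (v : Lp ℝ 2 ν)⟫_ℝ := by
  rw [form_eq_inner, integral_mul_eq_inner, neg_inj]

/-- An identity tested on cylindrical functions extends by continuity to the closure of the graph.
Closability identifies the Sobolev gradient of a cylindrical test function with its second component
in the graph. -/
theorem formGraph_le_coerciveFormGraph
    (hcl : ∀ v ∈ (gradientGraph Q 2 ν).topologicalClosure, v.1 = 0 → v.2 = 0)
    (C : KernelSpace Q →L[ℝ] KernelSpace Q) :
    formGraph Q ν C ≤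
      coerciveFormGraph (gradientGraph Q 2 ν).topologicalClosure (C.compLpL 2 ν) := by
  rintro ⟨x, y⟩ ⟨u, rfl, h⟩
  refine mem_coerciveFormGraph_topologicalClosure (mk_sobolevGradient_mem hcl u) fun z hz => ?_
  have hz' : (z.1, z.2) ∈ (gradientGraph Q 2 ν).topologicalClosure :=
    (gradientGraph Q 2 ν).le_topologicalClosure hz
  obtain ⟨f, hf, hf1, -⟩ := hz
  have hv : z.1 ∈ sobolev Q 2 ν := ⟨z, hz', rfl⟩
  have h1 := (form_eq_neg_integral_iff C u ⟨z.1, hv⟩ y).1 (h ⟨z.1, hv⟩ ⟨f, hf, hf1⟩)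
  rw [sobolevGradient_eq hcl ⟨z.1, hv⟩ hz'] at h1
  exact h1

theorem coerciveFormGraph_le_formGraph
    (hcl : ∀ v ∈ (gradientGraph Q 2 ν).topologicalClosure, v.1 = 0 → v.2 = 0)
    (C : KernelSpace Q →L[ℝ] KernelSpace Q) :
    coerciveFormGraph (gradientGraph Q 2 ν).topologicalClosure (C.compLpL 2 ν) ≤
      formGraph Q ν C := by
  intro w hw
  obtain ⟨p, hp, h⟩ := hw
  obtain ⟨u, hu, hup⟩ := exists_sobolevGradient_eq hcl hp
  refine ⟨u, hu, fun v _ => (form_eq_neg_integral_iff C u v w.2).2 ?_⟩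
  have h1 := h _ (mk_sobolevGradient_mem hcl v)
  rw [hup]
  exact h1

theorem formGraph_eq_coerciveFormGraph
    (hcl : ∀ v ∈ (gradientGraph Q 2 ν).topologicalClosure, v.1 = 0 → v.2 = 0)
    (C : KernelSpace Q →L[ℝ] KernelSpace Q) :
    formGraph Q ν C =
      coerciveFormGraph (gradientGraph Q 2 ν).topologicalClosure (C.compLpL 2 ν) :=
  le_antisymm (formGraph_le_coerciveFormGraph hcl C) (coerciveFormGraph_le_formGraph hcl C)

omit [CompleteSpace X] in
theorem adjoint_compLpL (C : KernelSpace Q →L[ℝ] KernelSpace Q) :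
    (ContinuousLinearMap.adjoint C).compLpL 2 ν = ContinuousLinearMap.adjoint (C.compLpL 2 ν) := by
  refine (ContinuousLinearMap.eq_adjoint_iff _ _).2 fun f g => ?_
  rw [L2.inner_def, L2.inner_def]
  refine integral_congr_ae ?_
  filter_upwards [(ContinuousLinearMap.adjoint C).coeFn_compLpL (p := 2) f,
    C.coeFn_compLpL (p := 2) g] with x h1 h2
  rw [h1, h2, ContinuousLinearMap.adjoint_inner_left]

omit [CompleteSpace X] in
theorem inner_compLpL_self {C : KernelSpace Q →L[ℝ] KernelSpace Q}
    (hC : ∀ h, ⟪C h, h⟫_ℝ = -(‖h‖ ^ 2 / 2)) (f : Lp (KernelSpace Q) 2 ν) :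
    ⟪C.compLpL 2 ν f, f⟫_ℝ = -(1 / 2 * ‖f‖ ^ 2) := by
  rw [← real_inner_self_eq_norm_sq, L2.inner_def, L2.inner_def, ← integral_const_mul,
    ← integral_neg]
  refine integral_congr_ae ?_
  filter_upwards [C.coeFn_compLpL (p := 2) f] with x h1
  rw [h1, hC, real_inner_self_eq_norm_sq]
  ring

variable [SecondCountableTopology X] [BorelSpace X]

/-- Cylindrical functions are dense in `L²`. -/
theorem dense_fst_gradientGraph [IsFiniteMeasure ν] :
    Dense (Prod.fst '' ((gradientGraph Q 2 ν).topologicalClosure :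
      Set (Lp ℝ 2 ν × Lp (KernelSpace Q) 2 ν))) := by
  let D : Submodule ℝ (Lp ℝ 2 ν) :=
    (gradientGraph Q 2 ν).topologicalClosure.map (LinearMap.fst ℝ _ _)
  suffices h : D.topologicalClosure = ⊤ by
    have := (Submodule.dense_iff_topologicalClosure_eq_top (s := D)).2 h
    exact this
  rw [Submodule.topologicalClosure_eq_top_iff, Submodule.eq_bot_iff]
  intro φ hφ
  rw [Lp.eq_zero_iff_ae_eq_zero]
  refine ae_eq_zero_of_forall_isCylindrical ((Lp.memLp φ).integrable one_le_two) fun f hf => ?_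
  have hfb := hf.isC1Bounded
  obtain ⟨M, hM⟩ := hfb.bounded
  obtain ⟨N, hN⟩ := hfb.bounded_fderiv
  have hf2 : MemLp f 2 ν :=
    MemLp.of_bound hfb.continuous.aestronglyMeasurable M (Eventually.of_forall hM)
  have hgm : AEStronglyMeasurable (gradient Q f) ν := by
    obtain ⟨n, ψ, ξ, hψ, hfψ⟩ := hf
    have h1 : gradient Q f = fun x =>
        ∑ j, fderiv ℝ ψ (fun j => ξ j x) (Pi.single j 1) • inclusionAdj Q (ξ j) := by
      rw [funext hfψ]
      exact funext fun x => gradient_cylindrical Q hψ ξ x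
    rw [h1]
    refine Finset.aestronglyMeasurable_fun_sum _ fun j _ => ?_
    have h2 : Continuous fun x => fderiv ℝ ψ (fun j => ξ j x) (Pi.single j 1) :=
      ((hψ.contDiff.continuous_fderiv one_ne_zero).comp
        (continuous_pi fun j => (ξ j).continuous)).clm_apply continuous_const
    exact h2.aestronglyMeasurable.smul_const _
  have hg2 : MemLp (gradient Q f) 2 ν := MemLp.of_bound hgm (‖inclusionAdj Q‖ * N)
    (Eventually.of_forall fun x => (inclusionAdj Q).le_opNorm _ |>.trans (by gcongr; exact hN x))
  have h0 : ⟪hf2.toLp, φ⟫_ℝ = 0 := hφ _ ⟨(hf2.toLp, hg2.toLp),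
    Submodule.le_topologicalClosure _ ⟨f, hf, hf2.coeFn_toLp, hg2.coeFn_toLp⟩, rfl⟩
  rw [L2.inner_def] at h0
  rw [← h0]
  refine integral_congr_ae ?_
  filter_upwards [hf2.coeFn_toLp] with x hx
  rw [hx]
  simp [mul_comm]

end FormOperator

end

end OrnsteinUhlenbeck

/-! ### The main theorem. -/

open OrnsteinUhlenbeck in
theorem mainTheorem5 {X : Type*} [NormedAddCommGroup X] [NormedSpace ℝ X] [CompleteSpace X]
    [TopologicalSpace.SeparableSpace X] [MeasurableSpace X] [BorelSpace X]
    (Q : NonnegSymmOp X)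
    (S : ℝ≥0 → X →L[ℝ] X) (hS : IsContractionSemigroup S)
    (hQt : ∀ t : ℝ, 0 < t → ∃ μt : Measure X, IsCenteredGaussian μt (covarianceAt Q S t))
    (Qinf : StrongDual ℝ X →L[ℝ] X)
    (hlim : ∀ a b : StrongDual ℝ X,
      Tendsto (fun t : ℝ => b (covarianceAt Q S t a)) atTop (𝓝 (b (Qinf a))))
    (μ : Measure X) (hμ : IsCenteredGaussian μ Qinf) (hμ_nondeg : μ.IsOpenPosMeasure)
    (hB : DriftBound Q (generator S) Qinf)
    (U : X → EReal) (hU : IsWeightFunction Q μ U)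
    (ν : Measure X) (hν : ν = weightedMeasure μ U)
    (B : KernelSpace Q →L[ℝ] KernelSpace Q) (hB' : B = driftOperator Q (generator S) Qinf)
    (L₂ Ltilde₂ : Lp ℝ 2 ν →ₗ.[ℝ] Lp ℝ 2 ν)
    (hL : L₂ = formOperator Q ν B)
    (hLtilde : Ltilde₂ = formOperator Q ν (ContinuousLinearMap.adjoint B)) :
    Ltilde₂ = L₂.adjoint ∧
      ∃ T₂ Ttilde₂ : ℝ≥0 → Lp ℝ 2 ν →L[ℝ] Lp ℝ 2 ν,
        IsContractionSemigroup T₂ ∧ generator T₂ = L₂ ∧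
        IsContractionSemigroup Ttilde₂ ∧ generator Ttilde₂ = Ltilde₂ ∧
        ∀ t, Ttilde₂ t = ContinuousLinearMap.adjoint (T₂ t) := by
  have : SecondCountableTopology X := UniformSpace.secondCountable_of_separable X
  have hgauss := hμ.gaussian
  have hsymm (a b : StrongDual ℝ X) : b (Qinf a) = a (Qinf b) := by
    rw [hμ.covariance, hμ.covariance]
    simp only [mul_comm]
  have hdrift : IsDriftOperator Q (generator S) Qinf B :=
    hB' ▸ hS.isDriftOperator_driftOperator Q hB
  have hBself (h : KernelSpace Q) : ⟪B h, h⟫_ℝ = -(‖h‖ ^ 2 / 2) :=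
    hS.inner_driftOperator_self Q hlim hsymm hdrift h
  -- With `p = 4` the square of the gradient of `U` is in `L²(μ)`, to be paired with `e^{-U} ∈
  -- L²(μ)`. From here on `U` is replaced by its real-valued Sobolev representative.
  obtain ⟨u, ⟨w, hw, hwu⟩, huU⟩ := hU.mem_sobolev 4 (by simp)
  have hw1 : w.1 = u := hwu
  subst hw1
  obtain ⟨a, c, hac⟩ := exists_affine_le hU.ne_bot hU.proper hU.lsc hU.convex_epigraph
  have hexp : MemLp (fun x => Real.exp (-w.1 x)) 2 μ := by
    refine memLp_exp_neg (Lp.aestronglyMeasurable w.1) (a := a) (c := c) ?_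
    filter_upwards [huU] with x hx
    exact hac x _ hx.ge
  obtain rfl : ν = expMeasure μ w.1 := hν.trans (weightedMeasure_eq huU)
  have hfin := isFiniteMeasure_expMeasure (hexp.integrable (by simp))
  have hcl : ∀ v ∈ (gradientGraph Q 2 (expMeasure μ w.1)).topologicalClosure,
      v.1 = 0 → v.2 = 0 := by
    intro v hv hv0
    -- The directions `B i* ξ` are mapped by `i` to `Q_∞ A* ξ`, so integration by parts along them
    -- is available, and they are total in `H`.
    refine hμ.closable_gradientGraph hw hexp (ν := expMeasure μ w.1)
      (s := Set.range fun ξ : (dualAdjoint (generator S)).domain => B (inclusionAdj Q ξ))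
      (fun k hk => ?_) ?_ rfl hv hv0
    · exact hS.eq_zero_of_forall_inner_driftOperator Q hBself fun ξ => hk _ ⟨ξ, rfl⟩
    · rintro _ ⟨ξ, rfl⟩
      exact ⟨_, hdrift ξ⟩
  have hBcoer (f : Lp (KernelSpace Q) 2 (expMeasure μ w.1)) :
      ⟪B.compLpL 2 (expMeasure μ w.1) f, f⟫_ℝ ≤ -(1 / 2 * ‖f‖ ^ 2) :=
    (inner_compLpL_self hBself f).le
  rw [formOperator, formGraph_eq_coerciveFormGraph hcl] at hL hLtilde
  rw [adjoint_compLpL] at hLtilde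
  exact exists_semigroup_coerciveFormGraph
    (gradientGraph Q 2 (expMeasure μ w.1)).isClosed_topologicalClosure
    dense_fst_gradientGraph one_half_pos hBcoer hL hLtilde
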